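/- Let $\Omega\subset\mathbb{C}^n$ be a bounded Reinhardt domain, i.e. a nonempty bounded connected open set such that $(e^{i\theta_1}z_1,\ldots,e^{i\theta_n}z_n)\in\Omega$ whenever $(z_1,\ldots,z_n)\in\Omega$ and $\theta_1,\ldots,\theta_n\in\mathbb{R}$. Let $A^2(\Omega)$ be the Bergman space of $\Omega$, i.e. the closed subspace of $L^2(\Omega)$ (with respect to Lebesgue measure) consisting of the holomorphic functions, let $P:L^2(\Omega)\to A^2(\Omega)$ be the orthogonal projection, and for $\phi\in L^\infty(\Omega)$ let $T_\phi:A^2(\Omega)\to A^2(\Omega)$, $T_\phi f=P(\phi f)$, be the Toeplitz operator with symbol $\phi$. A function $\psi$ on $\Omega$ is called (separately) quasi-homogeneous if there exist $f:[0,\infty)^n\to\mathbb{C}$ and $(k_1,\ldots,k_n)\in\mathbb{Z}^n$ such that $$\psi(r_1e^{i\theta_1},\ldots,r_ne^{i\theta_n})=f(r_1,\ldots,r_n)\,e^{i(k_1\theta_1+\cdots+k_n\theta_n)}$$ whenever $r_j\ge 0$, $\theta_j\in\mathbb{R}$ and $(r_1e^{i\theta_1},\ldots,r_ne^{i\theta_n})\in\Omega$.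 Let $\phi_1,\ldots,\phi_m\in L^\infty(\Omega)$ each be a finite sum of bounded quasi-homogeneous functions on $\Omega$ (functions in $L^\infty(\Omega)$ are identified when they agree almost everywhere). If $T_{\phi_m}\cdots T_{\phi_1}=0$ on $A^2(\Omega)$, then $\phi_j=0$ (almost everywhere on $\Omega$) for some $j\in\{1,\ldots,m\}$. -/

import Mathlib

open MeasureTheory Filter Topology
open scoped ENNReal NNReal

namespace ReinhardtToeplitz

/-- Mean value property over polydiscs. -/
theorem mean_value {n : ℕ} {g : (Fin n → ℂ) → ℂ} {z : Fin n → ℂ} {r R : ℝ} (hrR : r < R)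
    (hg : DifferentiableOn ℂ g (Metric.ball z R)) :
    (volume.real (Metric.closedBall (0 : Fin n → ℂ) r) : ℂ) * g z =
      ∫ w in Metric.closedBall (0 : Fin n → ℂ) r, g (z + w) := by
  set B : Set (Fin n → ℂ) := Metric.closedBall 0 r with hB
  have hcirc : ∀ w ∈ B, Real.circleAverage (fun t : ℂ => g (z + t • w)) 0 1 = g z := by
    intro w hw
    have hmaps : ∀ t ∈ Metric.closedBall (0 : ℂ) 1, z + t • w ∈ Metric.ball z R := by
      intro t ht
      have ht' : ‖t‖ ≤ 1 := by simpa using ht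
      have hw' : ‖w‖ ≤ r := by simpa [hB] using hw
      have : ‖t • w‖ ≤ r := by
        rw [norm_smul]
        nlinarith [norm_nonneg w, norm_nonneg t]
      simpa [Metric.mem_ball, dist_eq_norm] using lt_of_le_of_lt this hrR
    have hd : DifferentiableOn ℂ (fun t : ℂ => g (z + t • w)) (Metric.closedBall 0 1) :=
      hg.comp (by fun_prop) hmaps
    have := DiffContOnCl.circleAverage (f := fun t : ℂ => g (z + t • w)) (c := 0) (R := 1)
      (DifferentiableOn.diffContOnCl (by
        rw [abs_one, closure_ball _ one_ne_zero]; exact hd))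
    simpa using this
  have hmp : ∀ θ : ℝ, MeasurePreserving (fun w : Fin n → ℂ => circleMap 0 1 θ • w) := by
    intro θ
    have hu : ‖circleMap 0 1 θ‖ = 1 := by simp
    have h1 : MeasurePreserving (fun x : ℂ => circleMap 0 1 θ * x) := by
      exact (rotation
        (⟨circleMap 0 1 θ, by simp [Submonoid.unitSphere]⟩ : Circle)).measurePreserving
    exact volume_preserving_pi (fun _ => h1)
  have hrot : ∀ θ : ℝ, ∫ w in B, g (z + circleMap 0 1 θ • w) = ∫ w in B, g (z + w) := by
    intro θ
    have hu : ‖circleMap 0 1 θ‖ = 1 := by simp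
    have hne : circleMap 0 1 θ ≠ 0 := by
      intro h; rw [h] at hu; simp at hu
    have hemb : MeasurableEmbedding (fun w : Fin n → ℂ => circleMap 0 1 θ • w) :=
      measurableEmbedding_const_smul₀ hne
    have := (hmp θ).setIntegral_preimage_emb hemb (fun w => g (z + w)) B
    rw [← this]
    congr 2
    ext w
    simp [hB, norm_smul, hu]
  have hint : Integrable (Function.uncurry fun (θ : ℝ) (w : Fin n → ℂ) =>
      g (z + circleMap 0 1 θ • w))
      ((volume.restrict (Set.uIoc 0 (2 * Real.pi))).prod (volume.restrict B)) := by
    rw [Measure.prod_restrict]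
    have hc : ContinuousOn (Function.uncurry fun (θ : ℝ) (w : Fin n → ℂ) =>
        g (z + circleMap 0 1 θ • w)) (Set.uIcc 0 (2 * Real.pi) ×ˢ B) := by
      refine hg.continuousOn.comp (f := fun p : ℝ × (Fin n → ℂ) => z + circleMap 0 1 p.1 • p.2)
        (Continuous.continuousOn (by fun_prop)) ?_
      rintro ⟨θ, w⟩ ⟨-, hw⟩
      have hw' : ‖w‖ ≤ r := by simpa [hB] using hw
      have : ‖circleMap 0 1 θ • w‖ ≤ r := by simpa [norm_smul] using hw'
      simpa [Metric.mem_ball, dist_eq_norm] using lt_of_le_of_lt this hrR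
    have := hc.integrableOn_compact (μ := (volume : Measure ℝ).prod (volume : Measure (Fin n → ℂ)))
      (isCompact_uIcc.prod (isCompact_closedBall _ _))
    exact this.mono_set (Set.prod_mono Set.uIoc_subset_uIcc le_rfl)
  have hswap := intervalIntegral_integral_swap hint
  calc (volume.real B : ℂ) * g z = ∫ w in B, g z := by simp [Complex.real_smul]
    _ = ∫ w in B, (2 * Real.pi)⁻¹ • ∫ θ in (0 : ℝ)..2 * Real.pi, g (z + circleMap 0 1 θ • w) := by
        refine setIntegral_congr_fun Metric.isClosed_closedBall.measurableSet ?_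
        intro w hw
        simpa [Real.circleAverage] using (hcirc w hw).symm
    _ = (2 * Real.pi)⁻¹ • ∫ θ in (0 : ℝ)..2 * Real.pi, ∫ w in B, g (z + circleMap 0 1 θ • w) := by
        rw [integral_smul, hswap]
    _ = ∫ w in B, g (z + w) := by
        simp_rw [hrot]
        rw [intervalIntegral.integral_const, smul_smul, sub_zero,
          inv_mul_cancel₀ (by positivity), one_smul]

/-- Point evaluations are bounded by the `L²` norm. -/
theorem norm_sq_mul_volume_le {n : ℕ} {Ω : Set (Fin n → ℂ)} {g : (Fin n → ℂ) → ℂ}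
    (hg : DifferentiableOn ℂ g Ω) (u : Lp ℂ 2 (volume.restrict Ω))
    (hu : u =ᵐ[volume.restrict Ω] g) {z : Fin n → ℂ} {r R : ℝ} (hrR : r < R)
    (hsub : Metric.ball z R ⊆ Ω) :
    ‖g z‖ ^ 2 * volume.real (Metric.closedBall (0 : Fin n → ℂ) r) ≤ ‖u‖ ^ 2 := by
  have hnorm : ‖u‖ ^ 2 = ∫ x in Ω, ‖g x‖ ^ 2 := by
    have h1 : (‖u‖ : ℂ) ^ 2 = ∫ x in Ω, inner ℂ (u x) (u x) := by
      rw [← L2.inner_def, inner_self_eq_norm_sq_to_K]; rfl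
    have h2 : ∫ x in Ω, inner ℂ (u x) (u x) = ((∫ x in Ω, ‖g x‖ ^ 2 : ℝ) : ℂ) := by
      rw [← integral_complex_ofReal]
      refine integral_congr_ae ?_
      filter_upwards [hu] with x hx
      rw [hx, inner_self_eq_norm_sq_to_K]
      norm_cast
    exact_mod_cast h1.trans h2
  have hgi : IntegrableOn (fun x => ‖g x‖ ^ 2) Ω := by
    have : MemLp g 2 (volume.restrict Ω) := (memLp_congr_ae hu).1 (Lp.memLp u)
    exact this.integrable_norm_pow two_ne_zero
  have hmv := mean_value hrR ((hg.mono hsub).pow 2)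
  have hpre : (fun w : Fin n → ℂ => z + w) ⁻¹' (Metric.closedBall z r) = Metric.closedBall 0 r := by
    ext w; simp
  have htr : ∫ w in Metric.closedBall (0 : Fin n → ℂ) r, ‖g (z + w)‖ ^ 2 =
      ∫ x in Metric.closedBall z r, ‖g x‖ ^ 2 := by
    rw [← hpre]
    exact (measurePreserving_add_left volume z).setIntegral_preimage_emb
      (measurableEmbedding_addLeft z) (fun x => ‖g x‖ ^ 2) _
  calc ‖g z‖ ^ 2 * volume.real (Metric.closedBall (0 : Fin n → ℂ) r)
      = ‖(volume.real (Metric.closedBall (0 : Fin n → ℂ) r) : ℂ) * (g z) ^ 2‖ := by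
        rw [norm_mul, norm_pow, Complex.norm_real, Real.norm_of_nonneg measureReal_nonneg, mul_comm]
    _ = ‖∫ w in Metric.closedBall (0 : Fin n → ℂ) r, (g (z + w)) ^ 2‖ := by
        rw [← Pi.pow_apply, hmv]; rfl
    _ ≤ ∫ w in Metric.closedBall (0 : Fin n → ℂ) r, ‖g (z + w)‖ ^ 2 := by
        refine (norm_integral_le_integral_norm _).trans_eq ?_
        simp
    _ = ∫ x in Metric.closedBall z r, ‖g x‖ ^ 2 := htr
    _ ≤ ∫ x in Ω, ‖g x‖ ^ 2 :=
        setIntegral_mono_set hgi (Eventually.of_forall fun x => by positivity)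
          (((Metric.closedBall_subset_ball hrR).trans hsub).eventuallyLE)
    _ = ‖u‖ ^ 2 := hnorm.symm

/-- The Bergman space `A²(Ω)`: the subspace of `L²(Ω)` (with respect to Lebesgue measure) of
classes having a holomorphic representative on `Ω`. -/
def bergmanSpace {n : ℕ} (Ω : TopologicalSpace.Opens (Fin n → ℂ)) :
    Submodule ℂ (Lp ℂ 2 (volume.restrict (Ω : Set (Fin n → ℂ)))) where
  carrier := {u | ∃ g : (Fin n → ℂ) → ℂ, DifferentiableOn ℂ g Ω ∧
    u =ᵐ[volume.restrict (Ω : Set (Fin n → ℂ))] g}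
  add_mem' := by
    rintro u v ⟨g, hg, hug⟩ ⟨h, hh, hvh⟩
    exact ⟨g + h, hg.add hh, (Lp.coeFn_add u v).trans (hug.add hvh)⟩
  zero_mem' := ⟨0, differentiableOn_const 0, Lp.coeFn_zero _ _ _⟩
  smul_mem' := by
    rintro c u ⟨g, hg, hug⟩
    exact ⟨c • g, hg.const_smul c, (Lp.coeFn_smul c u).trans (hug.const_smul c)⟩

/-- Along an `L²`-convergent sequence, holomorphic representatives are locally uniformly Cauchy. -/
theorem uniformCauchySeqOn {n : ℕ} {Ω : Set (Fin n → ℂ)}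
    {u : ℕ → Lp ℂ 2 (volume.restrict Ω)} (hu : CauchySeq u) {g : ℕ → (Fin n → ℂ) → ℂ}
    (hg : ∀ k, DifferentiableOn ℂ (g k) Ω) (hug : ∀ k, u k =ᵐ[volume.restrict Ω] g k)
    {z₀ : Fin n → ℂ} {R : ℝ} (hR : 0 < R) (hsub : Metric.ball z₀ (3 * R) ⊆ Ω) :
    UniformCauchySeqOn g atTop (Metric.ball z₀ R) := by
  set V := volume.real (Metric.closedBall (0 : Fin n → ℂ) R) with hV
  have hVpos : 0 < V :=
    ENNReal.toReal_pos (Metric.measure_closedBall_pos _ _ hR).ne' measure_closedBall_lt_top.ne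
  rw [Metric.uniformCauchySeqOn_iff]
  intro ε hε
  obtain ⟨N, hN⟩ := Metric.cauchySeq_iff.1 hu (ε * √V) (by positivity)
  refine ⟨N, fun k hk l hl z hz => ?_⟩
  have hb : Metric.ball z (2 * R) ⊆ Ω := by
    refine (Metric.ball_subset_ball' ?_).trans hsub
    have := Metric.mem_ball.1 hz
    linarith
  have h := norm_sq_mul_volume_le ((hg k).sub (hg l)) (u k - u l)
    ((Lp.coeFn_sub _ _).trans ((hug k).sub (hug l))) (r := R) (R := 2 * R) (by linarith) hb
  have hlt := hN k hk l hl
  rw [dist_eq_norm] at hlt ⊢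
  have h2 : ‖u k - u l‖ ^ 2 < (ε * √V) ^ 2 := by gcongr
  rw [mul_pow, Real.sq_sqrt hVpos.le] at h2
  have h3 : ‖g k z - g l z‖ ^ 2 < ε ^ 2 := lt_of_mul_lt_mul_right (h.trans_lt h2) hVpos.le
  exact lt_of_pow_lt_pow_left₀ 2 hε.le h3

/-- Locally uniform limits of holomorphic functions of several variables are holomorphic. -/
theorem differentiableAt_of_uniformCauchy {n : ℕ} {g : ℕ → (Fin n → ℂ) → ℂ}
    {G : (Fin n → ℂ) → ℂ} {z₀ : Fin n → ℂ} {R : ℝ} (hR : 0 < R)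
    (hg : ∀ k, DifferentiableOn ℂ (g k) (Metric.ball z₀ (2 * R)))
    (hc : UniformCauchySeqOn g atTop (Metric.ball z₀ (2 * R)))
    (hG : ∀ z ∈ Metric.ball z₀ (2 * R), Tendsto (fun k => g k z) atTop (𝓝 (G z))) :
    DifferentiableAt ℂ G z₀ := by
  have hdiff : ∀ k, ∀ z ∈ Metric.ball z₀ (2 * R), DifferentiableAt ℂ (g k) z := fun k z hz =>
    (hg k).differentiableAt (Metric.isOpen_ball.mem_nhds hz)
  have hsub : Metric.ball z₀ R ⊆ Metric.ball z₀ (2 * R) := Metric.ball_subset_ball (by linarith)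
  have hd : UniformCauchySeqOn (fun k => fderiv ℂ (g k)) atTop (Metric.ball z₀ R) := by
    rw [Metric.uniformCauchySeqOn_iff] at hc ⊢
    intro ε hε
    obtain ⟨N, hN⟩ := hc (ε * R / 4) (by positivity)
    refine ⟨N, fun k hk l hl z hz => ?_⟩
    have hb : Metric.ball z R ⊆ Metric.ball z₀ (2 * R) := by
      refine Metric.ball_subset_ball' ?_
      have := Metric.mem_ball.1 hz
      linarith
    have h1 : fderiv ℂ (g k) z - fderiv ℂ (g l) z = fderiv ℂ (g k - g l) z :=
      (fderiv_sub (hdiff k z (hsub hz)) (hdiff l z (hsub hz))).symm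
    have h2 : ‖fderiv ℂ (g k - g l) z‖ ≤ (ε * R / 2) / R := by
      refine Complex.norm_fderiv_le_div_of_mapsTo_ball (((hg k).sub (hg l)).mono hb) ?_ hR
      intro w hw
      have h3 := hN k hk l hl w (hb hw)
      have h4 := hN k hk l hl z (hsub hz)
      rw [dist_eq_norm] at h3 h4
      rw [Metric.mem_closedBall, dist_eq_norm]
      refine (norm_sub_le _ _).trans ?_
      simp only [Pi.sub_apply]
      linarith
    rw [dist_eq_norm, h1]
    refine h2.trans_lt ?_
    rw [div_lt_iff₀ hR]
    nlinarith [mul_pos hε hR]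
  have hex : ∀ z ∈ Metric.ball z₀ R, ∃ L, Tendsto (fun k => fderiv ℂ (g k) z) atTop (𝓝 L) :=
    fun z hz => cauchySeq_tendsto_of_complete (hd.cauchySeq hz)
  choose! G' hG' using hex
  exact (hasFDerivAt_of_tendstoUniformlyOn Metric.isOpen_ball
    (hd.tendstoUniformlyOn_of_tendsto hG') (fun k z hz => (hdiff k z (hsub hz)).hasFDerivAt)
    (fun z hz => hG z (hsub hz)) (Metric.mem_ball_self hR)).differentiableAt

/-- `A²(Ω)` is closed in `L²(Ω)`. -/
theorem isClosed_bergmanSpace {n : ℕ} (Ω : TopologicalSpace.Opens (Fin n → ℂ)) :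
    IsClosed (bergmanSpace Ω : Set (Lp ℂ 2 (volume.restrict (Ω : Set (Fin n → ℂ))))) := by
  refine IsSeqClosed.isClosed ?_
  intro u v hu huv
  choose g hg hug using hu
  have hball : ∀ z ∈ Ω, ∃ R > 0, Metric.ball z (3 * R) ⊆ (Ω : Set (Fin n → ℂ)) := by
    intro z hz
    obtain ⟨R, hR, hs⟩ := Metric.isOpen_iff.1 Ω.isOpen z hz
    exact ⟨R / 3, by positivity, by rwa [mul_div_cancel₀ _ three_ne_zero]⟩
  have hlim : ∀ z ∈ Ω, ∃ c, Tendsto (fun k => g k z) atTop (𝓝 c) := by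
    intro z hz
    obtain ⟨R, hR, hs⟩ := hball z hz
    exact cauchySeq_tendsto_of_complete
      ((uniformCauchySeqOn huv.cauchySeq hg hug hR hs).cauchySeq (Metric.mem_ball_self hR))
  choose! G hG using hlim
  refine ⟨G, ?_, ?_⟩
  · intro z hz
    obtain ⟨R, hR, hs⟩ := hball z hz
    have hs' : Metric.ball z (2 * (R / 2)) ⊆ (Ω : Set (Fin n → ℂ)) :=
      (Metric.ball_subset_ball (by linarith)).trans hs
    refine (differentiableAt_of_uniformCauchy (half_pos hR) (fun k => (hg k).mono hs') ?_
      (fun w hw => hG w (hs' hw))).differentiableWithinAt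
    rw [mul_div_cancel₀ _ two_ne_zero]
    exact uniformCauchySeqOn huv.cauchySeq hg hug hR hs
  · obtain ⟨ns, hns, hae⟩ := (tendstoInMeasure_of_tendsto_Lp huv).exists_seq_tendsto_ae
    filter_upwards [hae, ae_all_iff.2 hug, ae_restrict_mem Ω.isOpen.measurableSet] with z h1 h2 h3
    refine tendsto_nhds_unique h1 ?_
    simp_rw [h2]
    exact (hG z h3).comp hns.tendsto_atTop

instance {n : ℕ} (Ω : TopologicalSpace.Opens (Fin n → ℂ)) :
    (bergmanSpace Ω).HasOrthogonalProjection :=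
  haveI : CompleteSpace (bergmanSpace Ω) := (isClosed_bergmanSpace Ω).completeSpace_coe
  inferInstance

/-- The Toeplitz operator `T_φ f = P (φ f)` on `A²(Ω)`, where `φ ∈ L^∞(Ω)` and `P` is the orthogonal
projection of `L²(Ω)` onto `A²(Ω)`. -/
noncomputable def toeplitz {n : ℕ} (Ω : TopologicalSpace.Opens (Fin n → ℂ))
    (φ : Lp ℂ ∞ (volume.restrict (Ω : Set (Fin n → ℂ)))) :
    bergmanSpace Ω →L[ℂ] bergmanSpace Ω :=
  (bergmanSpace Ω).orthogonalProjectionOnto ∘L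
    (ContinuousLinearMap.mul ℂ ℂ).holderL (volume.restrict (Ω : Set (Fin n → ℂ))) ∞ 2 2 φ ∘L
      (bergmanSpace Ω).subtypeL

/-- Invariance under all rotations `(z₁, …, zₙ) ↦ (e^{iθ₁} z₁, …, e^{iθₙ} zₙ)`. -/
def IsReinhardt {n : ℕ} (Ω : Set (Fin n → ℂ)) : Prop :=
  ∀ z ∈ Ω, ∀ θ : Fin n → ℝ, (fun j => Complex.exp (θ j * Complex.I) * z j) ∈ Ω

/-- `ψ` is (separately) quasi-homogeneous on `Ω`: there are `f : [0,∞)ⁿ → ℂ` and `k ∈ ℤⁿ` with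
`ψ (r₁ e^{iθ₁}, …, rₙ e^{iθₙ}) = f (r₁, …, rₙ) e^{i (k₁ θ₁ + ⋯ + kₙ θₙ)}`. -/
def IsQuasiHomogeneousOn {n : ℕ} (Ω : Set (Fin n → ℂ)) (ψ : (Fin n → ℂ) → ℂ) : Prop :=
  ∃ (f : (Fin n → ℝ≥0) → ℂ) (k : Fin n → ℤ), ∀ (r : Fin n → ℝ≥0) (θ : Fin n → ℝ),
    (fun j => ((r j : ℝ) : ℂ) * Complex.exp (θ j * Complex.I)) ∈ Ω →
      ψ (fun j => ((r j : ℝ) : ℂ) * Complex.exp (θ j * Complex.I)) =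
        f r * Complex.exp ((∑ j, (k j : ℂ) * (θ j : ℂ)) * Complex.I)

/-- `φ ∈ L^∞(Ω)` is a finite sum of bounded quasi-homogeneous functions, i.e. of elements of
`L^∞(Ω)` having a quasi-homogeneous representative. -/
def IsFiniteSumQuasiHomogeneous {n : ℕ} {Ω : Set (Fin n → ℂ)}
    (φ : Lp ℂ ∞ (volume.restrict Ω)) : Prop :=
  ∃ (N : ℕ) (ψ : Fin N → Lp ℂ ∞ (volume.restrict Ω)),
    (∀ i, ∃ ψ₀ : (Fin n → ℂ) → ℂ, IsQuasiHomogeneousOn Ω ψ₀ ∧ ψ i =ᵐ[volume.restrict Ω] ψ₀) ∧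
      φ = ∑ i, ψ i

end ReinhardtToeplitz

namespace ReinhardtToeplitz

/-! Group each symbol into components of distinct weights under the torus action. If `φ` has weight
`k`, then `φ z^δ` has weight `δ + k`; the Bergman projection commutes with rotations, and a
holomorphic function of weight `δ + k ≥ 0` is a multiple of `z^(δ+k)`. So `T_φ` acts on monomials of
large degree as a weighted shift (`toeplitz_monomialVec`), and the given operators act as finite
sums of shifts. Monomials with nonnegative exponents suffice: they lie in `A²` because the domain is
bounded, and the Laurent monomials that `A²` may also contain are never needed.

Order degrees lexicographically, a total order compatible with addition. In the image of `z^δ` under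
the product, the term of highest degree comes only from the lexicographically largest weight of each
symbol, and it is orthogonal to all the others. Since the product of operators is zero, the product
of these leading coefficients vanishes for every large `δ` (`exists_prod_leading_coeff_eq_zero`).

Up to nonzero factors, the coefficients are moments in `|z_i|²` of complex measures, one per symbol.
It remains to see that if products of moments vanish, then one measure has vanishing moments
(`exists_moments_eq_zero`). The products are the moments of the multiplicative convolution of the
measures. By Stone–Weierstrass that convolution kills all continuous functions, in particular all
real powers with positive exponents. Moments with real exponents extend holomorphically along
complex lines of exponents, so if each measure had a nonzero moment, all of them would be nonzero at
one common exponent, a contradiction. Finally, a symbol of given weight whose moments vanish is zero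
(`eq_zero_of_moments_eq_zero`), which contradicts the choice of a nonzero leading component. -/

/-! ### Moments of complex measures -/

/-- An integral depending on a complex parameter is holomorphic as soon as the integrand is
holomorphic in the parameter and dominated by an integrable function. -/
theorem differentiableOn_integral {Y : Type*} [MeasurableSpace Y] {μ : Measure Y} {U : Set ℂ}
    (hU : IsOpen U) {f : ℂ → Y → ℂ} {bound : Y → ℝ} (hbound : Integrable bound μ)
    (hmeas : ∀ s, AEStronglyMeasurable (f s) μ)
    (hdiff : ∀ y, DifferentiableOn ℂ (fun s => f s y) U)
    (hle : ∀ s ∈ U, ∀ y, ‖f s y‖ ≤ bound y) :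
    DifferentiableOn ℂ (fun s => ∫ y, f s y ∂μ) U := by
  intro s₀ hs₀
  obtain ⟨R, hR, hball⟩ := Metric.isOpen_iff.1 hU s₀ hs₀
  -- With radius `R / 3`, the closed disc around each point of the small ball stays in `U`, so
  -- Cauchy's estimate bounds the derivative by `bound y / (R / 3)`.
  have hr : 0 < R / 3 := by positivity
  have hda : ∀ y, ∀ s ∈ U, HasDerivAt (fun s => f s y) (deriv (fun s => f s y) s) s :=
    fun y s hs => ((hdiff y).differentiableAt (hU.mem_nhds hs)).hasDerivAt
  have hsub : ∀ s ∈ Metric.ball s₀ (R / 3), Metric.closedBall s (R / 3) ⊆ U := by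
    intro s hs
    refine (Metric.closedBall_subset_ball' ?_).trans hball
    have := Metric.mem_ball.1 hs
    linarith
  refine (hasDerivAt_integral_of_dominated_loc_of_deriv_le (s := Metric.ball s₀ (R / 3))
    (F' := fun s y => deriv (fun s => f s y) s) (bound := fun y => bound y / (R / 3))
    (Metric.ball_mem_nhds _ hr) (Eventually.of_forall hmeas) ?_ ?_ ?_ (hbound.div_const _)
    ?_).2.differentiableAt.differentiableWithinAt
  · exact hbound.mono' (hmeas s₀) (Eventually.of_forall (hle s₀ hs₀))
  -- The derivative is measurable as a limit of difference quotients.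
  · refine aestronglyMeasurable_of_tendsto_ae (𝓝[≠] s₀)
      (f := fun t y => slope (fun s => f s y) s₀ t) (fun t => ?_)
      (Eventually.of_forall fun y => (hda y s₀ hs₀).tendsto_slope)
    simp only [slope_def_module]
    exact ((hmeas t).sub (hmeas s₀)).const_smul ((t - s₀)⁻¹)
  · refine Eventually.of_forall fun y s hs => ?_
    refine Complex.norm_deriv_le_of_forall_mem_sphere_norm_le hr ?_ ?_
    · refine DifferentiableOn.diffContOnCl ?_
      rw [closure_ball _ hr.ne']
      exact (hdiff y).mono (hsub s hs)
    · exact fun z hz => hle z (hsub s hs (Metric.sphere_subset_closedBall hz)) y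
  · exact Eventually.of_forall fun y s hs => hda y s
      (hsub s hs (Metric.mem_closedBall_self hr.le))

/-- Stone–Weierstrass: if the moments of a complex measure of bounded support vanish, then so do
the integrals of all continuous functions. -/
theorem integral_comp_eq_zero_of_moments {Y : Type*} [MeasurableSpace Y] {μ : Measure Y} {n : ℕ}
    {H : Y → ℂ} (hH : Integrable H μ) {X : Y → Fin n → ℂ} (hX : Measurable X) {R : ℝ}
    (hXR : ∀ᵐ y ∂μ, ‖X y‖ ≤ R)
    (hmom : ∀ a b : Fin n → ℕ,
      ∫ y, H y * ∏ i, (X y i ^ a i * (starRingEnd ℂ) (X y i) ^ b i) ∂μ = 0)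
    (g : C(Fin n → ℂ, ℂ)) : ∫ y, H y * g (X y) ∂μ = 0 := by
  set K : Set (Fin n → ℂ) := Metric.closedBall 0 R with hK
  have : CompactSpace K := isCompact_iff_compactSpace.1 (isCompact_closedBall _ _)
  let coord : Fin n → C(Fin n → ℂ, ℂ) := fun i => ⟨fun z => z i, continuous_apply i⟩
  let S : StarSubalgebra ℂ C(Fin n → ℂ, ℂ) := StarAlgebra.adjoin ℂ (Set.range coord)
  have hint : ∀ p : C(Fin n → ℂ, ℂ), Integrable (fun y => H y * p (X y)) μ := by
    intro p
    obtain ⟨C, hC⟩ := (isCompact_closedBall (0 : Fin n → ℂ) R).exists_bound_of_continuousOn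
      p.continuous.continuousOn
    refine hH.mul_bdd (p.continuous.measurable.comp hX).aestronglyMeasurable (c := C) ?_
    filter_upwards [hXR] with y hy
    exact hC _ (by simpa using hy)
  have hS : ∀ p ∈ S, ∫ y, H y * p (X y) ∂μ = 0 := by
    intro p hp
    -- The star algebra generated by the coordinates is the linear span of the monomials in the
    -- coordinates and their conjugates, whose integrals vanish by `hmom`.
    have hmon : ∀ q ∈ Submonoid.closure (Set.range coord ∪ star (Set.range coord)),
        ∃ a b : Fin n → ℕ, ∀ z, q z = ∏ i, (z i ^ a i * (starRingEnd ℂ) (z i) ^ b i) := by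
      intro q hq
      induction hq using Submonoid.closure_induction with
      | mem x hx =>
        rcases hx with ⟨i, rfl⟩ | ⟨i, hi⟩
        · refine ⟨Pi.single i 1, 0, fun z => ?_⟩
          simp [coord, Pi.single_apply, pow_ite]
        · refine ⟨0, Pi.single i 1, fun z => ?_⟩
          rw [← star_star x, ← hi]
          simp [coord, Pi.single_apply, pow_ite]
      | one => exact ⟨0, 0, by simp⟩
      | mul x y _ _ hx hy =>
        obtain ⟨a, b, h⟩ := hx
        obtain ⟨a', b', h'⟩ := hy
        refine ⟨a + a', b + b', fun z => ?_⟩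
        rw [ContinuousMap.mul_apply, h, h', ← Finset.prod_mul_distrib]
        exact Finset.prod_congr rfl fun i _ => by simp only [Pi.add_apply]; ring
    have hp' : p ∈ Submodule.span ℂ
        (Submonoid.closure (Set.range coord ∪ star (Set.range coord)) : Set C(Fin n → ℂ, ℂ)) := by
      rw [← Algebra.adjoin_eq_span, ← StarAlgebra.adjoin_toSubalgebra]
      exact hp
    clear hp
    induction hp' using Submodule.span_induction with
    | mem x hx =>
      obtain ⟨a, b, h⟩ := hmon x hx
      simp_rw [h]
      exact hmom a b
    | zero => simp
    | add x y _ _ h1 h2 =>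
      simp_rw [ContinuousMap.add_apply, mul_add]
      rw [integral_add (hint x) (hint y), h1, h2, add_zero]
    | smul c x _ h =>
      simp_rw [ContinuousMap.smul_apply, mul_smul_comm]
      rw [integral_smul, h, smul_zero]
  let res : C(Fin n → ℂ, ℂ) →⋆ₐ[ℂ] C(K, ℂ) :=
    ContinuousMap.compStarAlgHom' ℂ ℂ ⟨Subtype.val, continuous_subtype_val⟩
  have hdense : (S.map res).topologicalClosure = ⊤ := by
    refine ContinuousMap.starSubalgebra_topologicalClosure_eq_top_of_separatesPoints _ ?_
    intro x y hxy
    obtain ⟨i, hi⟩ : ∃ i, x.1 i ≠ y.1 i := by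
      by_contra! h
      exact hxy (Subtype.ext (funext h))
    exact ⟨_, ⟨res (coord i), StarSubalgebra.mem_map.2
      ⟨coord i, StarAlgebra.subset_adjoin ℂ _ ⟨i, rfl⟩, rfl⟩, rfl⟩, hi⟩
  have hle : ∀ ε > 0, ‖∫ y, H y * g (X y) ∂μ‖ ≤ ε * ∫ y, ‖H y‖ ∂μ := by
    intro ε hε
    have hg : res g ∈ closure (S.map res : Set C(K, ℂ)) := by
      have : res g ∈ (S.map res).topologicalClosure := hdense ▸ StarSubalgebra.mem_top
      exact this
    obtain ⟨_, ⟨p, hp, rfl⟩, hpg⟩ := Metric.mem_closure_iff.1 hg ε hε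
    have hb : ∀ z ∈ K, ‖g z - p z‖ ≤ ε := by
      intro z hz
      have := ContinuousMap.dist_apply_le_dist (f := res g) (g := res p) ⟨z, hz⟩
      rw [dist_eq_norm] at this
      exact this.trans hpg.le
    have heq : ∫ y, H y * g (X y) ∂μ = ∫ y, H y * (g (X y) - p (X y)) ∂μ := by
      simp_rw [mul_sub]
      rw [integral_sub (hint g) (hint p), hS p hp, sub_zero]
    rw [heq, ← integral_const_mul]
    refine norm_integral_le_of_norm_le (hH.norm.const_mul ε) ?_
    filter_upwards [hXR] with y hy
    rw [norm_mul, mul_comm]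
    exact mul_le_mul_of_nonneg_right (hb _ (by simpa [hK] using hy)) (norm_nonneg _)
  have hI : 0 ≤ ∫ y, ‖H y‖ ∂μ := integral_nonneg fun _ => norm_nonneg _
  refine norm_le_zero_iff.1 (le_of_forall_pos_le_add fun δ hδ => ?_)
  -- The `+ 1` keeps the denominator positive when `H` vanishes almost everywhere.
  refine (hle (δ / (∫ y, ‖H y‖ ∂μ + 1)) (by positivity)).trans ?_
  rw [zero_add, div_mul_eq_mul_div, div_le_iff₀ (by positivity)]
  nlinarith

/-- The integrals `∫ h ∏ᵢ Xᵢ ^ wᵢ` over a line of exponents are holomorphic in the parameter of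
the line. -/
theorem differentiableOn_integral_cpow {Y : Type*} [MeasurableSpace Y] {μ : Measure Y} {n : ℕ}
    {X : Y → Fin n → ℝ} (hX : Measurable X) (hX0 : ∀ y i, 0 ≤ X y i) (hX1 : ∀ y i, X y i ≤ 1)
    {h : Y → ℂ} (hh : Integrable h μ) (v w : Fin n → ℝ) :
    DifferentiableOn ℂ
      (fun s : ℂ => ∫ y, h y * ∏ i, (X y i : ℂ) ^ ((v i : ℂ) + s * ((w i : ℂ) - v i)) ∂μ)
      {s | ∀ i, 0 < v i + s.re * (w i - v i)} := by
  have hre : ∀ (s : ℂ) i, ((v i : ℂ) + s * ((w i : ℂ) - v i)).re = v i + s.re * (w i - v i) := by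
    intro s i
    rw [← Complex.ofReal_sub]
    simp
  refine differentiableOn_integral ?_ hh.norm (fun s => ?_) (fun y => ?_) (fun s hs y => ?_)
  · rw [Set.ofPred_forall]
    exact isOpen_iInter_of_finite fun i =>
      isOpen_lt continuous_const (by fun_prop)
  · refine hh.aestronglyMeasurable.mul (Measurable.aestronglyMeasurable ?_)
    refine Finset.measurable_prod _ fun i _ => ?_
    exact (Complex.measurable_ofReal.comp ((measurable_pi_apply i).comp hX)).pow_const _
  -- Where `X y i = 0`, the power is holomorphic in its exponent only away from exponent `0`; this
  -- is why exponents are kept strictly positive.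
  · refine (differentiableOn_const _).mul (DifferentiableOn.fun_finsetProd fun i _ s hs => ?_)
    refine DifferentiableAt.differentiableWithinAt (DifferentiableAt.const_cpow (by fun_prop) ?_)
    right
    intro h0
    have := hre s i
    rw [h0] at this
    have h2 := hs i
    simp only [Complex.zero_re] at this
    linarith
  · rw [norm_mul, norm_prod]
    refine mul_le_of_le_one_right (norm_nonneg _) (Finset.prod_le_one (fun _ _ => norm_nonneg _) ?_)
    intro i _
    have := hs i
    rw [Complex.norm_cpow_eq_rpow_re_of_nonneg (hX0 y i) (by rw [hre]; exact this.ne'), hre]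
    exact Real.rpow_le_one (hX0 y i) (hX1 y i) this.le

/-- Products of Laplace transforms (written multiplicatively) which are nonzero somewhere in the
orthant are nonzero at a common point. -/
theorem exists_forall_integral_rpow_ne_zero {Y : Type*} [MeasurableSpace Y] {μ : Measure Y}
    {n : ℕ} {ι : Type*} {X : Y → Fin n → ℝ} (hX : Measurable X) (hX0 : ∀ y i, 0 ≤ X y i)
    (hX1 : ∀ y i, X y i ≤ 1) {h : ι → Y → ℂ} (hh : ∀ j, Integrable (h j) μ)
    {α : ι → Fin n → ℝ} (hα : ∀ j i, 0 < α j i)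
    (hne : ∀ j, ∫ y, h j y * ∏ i, ((X y i ^ α j i : ℝ) : ℂ) ∂μ ≠ 0) (S : Finset ι) :
    ∃ v : Fin n → ℝ, (∀ i, 0 < v i) ∧
      ∀ j ∈ S, ∫ y, h j y * ∏ i, ((X y i ^ v i : ℝ) : ℂ) ∂μ ≠ 0 := by
  classical
  induction S using Finset.induction_on with
  | empty => exact ⟨1, by simp, by simp⟩
  | insert j₀ S _ ih =>
    obtain ⟨v, hv, hvS⟩ := ih
    -- Join `v`, good for `S`, to `α j₀`, good for `j₀`, by a complex line. Each `F j` is nonzero at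
    -- `0` or at `1` of the connected set `U`, so it has no zeros in a punctured neighbourhood of
    -- `0`, and a small real parameter works for all of them.
    set w := α j₀ with hw
    set U : Set ℂ := {s | ∀ i, 0 < v i + s.re * (w i - v i)} with hU
    let F : ι → ℂ → ℂ := fun j s =>
      ∫ y, h j y * ∏ i, (X y i : ℂ) ^ ((v i : ℂ) + s * ((w i : ℂ) - v i)) ∂μ
    have hFreal : ∀ j (s : ℝ), F j s =
        ∫ y, h j y * ∏ i, ((X y i ^ (v i + s * (w i - v i)) : ℝ) : ℂ) ∂μ := by
      intro j s
      refine integral_congr_ae (Eventually.of_forall fun y => ?_)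
      simp only
      congr 1
      refine Finset.prod_congr rfl fun i _ => ?_
      rw [Complex.ofReal_cpow (hX0 y i)]
      push_cast
      rfl
    have hUo : IsOpen U := by
      rw [hU, Set.ofPred_forall]
      exact isOpen_iInter_of_finite fun i => isOpen_lt continuous_const (by fun_prop)
    have hUc : IsPreconnected U := by
      refine Convex.isPreconnected ?_
      rw [hU, Set.ofPred_forall]
      refine convex_iInter fun i => ?_
      intro s hs t ht a b ha hb hab
      simp only [Set.mem_ofPred_eq, Complex.add_re, Complex.smul_re, smul_eq_mul] at hs ht ⊢
      have : v i + (a * s.re + b * t.re) * (w i - v i) =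
          a * (v i + s.re * (w i - v i)) + b * (v i + t.re * (w i - v i)) := by
        linear_combination (-v i) * hab
      rw [this]
      rcases ha.eq_or_lt with rfl | ha
      · have : b = 1 := by linarith
        subst this; linarith
      · have := mul_nonneg hb ht.le
        have := mul_pos ha hs
        linarith
    have h0U : (0 : ℂ) ∈ U := fun i => by simpa using hv i
    have h1U : (1 : ℂ) ∈ U := fun i => by simpa [hw] using hα j₀ i
    have hFan : ∀ j, AnalyticOnNhd ℂ (F j) U := fun j =>
      (differentiableOn_integral_cpow hX hX0 hX1 (hh j) v w).analyticOnNhd hUo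
    have hev : ∀ j ∈ insert j₀ S, ∀ᶠ s in 𝓝[≠] (0 : ℂ), F j s ≠ 0 := by
      intro j hj
      refine (hFan j 0 h0U).eventually_eq_zero_or_eventually_ne_zero.resolve_left fun hz => ?_
      have hzero := (hFan j).eqOn_zero_of_preconnected_of_eventuallyEq_zero hUc h0U hz
      rcases Finset.mem_insert.1 hj with rfl | hj
      · refine hne j ?_
        have h1 := hFreal j 1
        simp only [Complex.ofReal_one, one_mul, add_sub_cancel] at h1
        rw [← hw, ← h1]
        exact hzero h1U
      · refine hvS j hj ?_
        have h1 := hFreal j 0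
        simp only [Complex.ofReal_zero, zero_mul, add_zero] at h1
        rw [← h1]
        exact hzero h0U
    have hev2 := ((insert j₀ S).eventually_all.2 hev).and
      (eventually_nhdsWithin_of_eventually_nhds (hUo.mem_nhds h0U))
    have htend : Tendsto (fun s : ℝ => (s : ℂ)) (𝓝[≠] 0) (𝓝[≠] (0 : ℂ)) := by
      refine tendsto_nhdsWithin_of_tendsto_nhds_of_eventually_within _ ?_ ?_
      · exact (Complex.continuous_ofReal.tendsto' 0 0 (by simp)).mono_left nhdsWithin_le_nhds
      · filter_upwards [self_mem_nhdsWithin] with s hs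
        simpa using hs
    obtain ⟨s, hs, hsU⟩ := (htend.eventually hev2).exists
    refine ⟨fun i => v i + s * (w i - v i), fun i => by simpa using hsU i, fun j hj => ?_⟩
    rw [← hFreal]
    exact hs j hj

/-- If the products of the moments of finitely many complex measures on the unit cube vanish, then
so do all the moments (of positive order) of one of them. -/
theorem exists_moments_eq_zero {Y : Type*} [MeasurableSpace Y] {μ : Measure Y} [SigmaFinite μ]
    {n m : ℕ} {X : Y → Fin n → ℝ} (hX : Measurable X) (hX0 : ∀ y i, 0 ≤ X y i)
    (hX1 : ∀ y i, X y i ≤ 1) {h : Fin m → Y → ℂ} (hh : ∀ j, Integrable (h j) μ)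
    (hprod : ∀ a : Fin n → ℕ, ∏ j, ∫ y, h j y * ∏ i, (X y i : ℂ) ^ a i ∂μ = 0) :
    ∃ j, ∀ a : Fin n → ℕ, ∫ y, h j y * ∏ i, (X y i : ℂ) ^ (a i + 1) ∂μ = 0 := by
  by_contra! hcon
  choose a ha using hcon
  obtain ⟨v, hv, hne⟩ := exists_forall_integral_rpow_ne_zero (ι := Fin m) hX hX0 hX1 hh
    (α := fun j i => (a j i : ℝ) + 1) (fun j i => by positivity)
    (fun j => by
      convert ha j using 5 with y i
      rw [← Nat.cast_add_one, Real.rpow_natCast, Complex.ofReal_pow]) Finset.univ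
  have hX1' : ∀ (y : Fin m → Y) i, ∏ j, X (y j) i ≤ 1 := fun y i =>
    Finset.prod_le_one (fun j _ => hX0 _ _) fun j _ => hX1 _ _
  have hX0' : ∀ (y : Fin m → Y) i, 0 ≤ ∏ j, X (y j) i := fun y i =>
    Finset.prod_nonneg fun j _ => hX0 _ _
  -- The multiplicative convolution: the product measure on `Fin m → Y`, seen through the
  -- coordinatewise product of the points. By Fubini its moments are the products of the given ones.
  have key := integral_comp_eq_zero_of_moments (μ := Measure.pi fun _ : Fin m => μ)
    (H := fun y => ∏ j, h j (y j)) (Integrable.fintype_prod hh)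
    (X := fun y i => ((∏ j, X (y j) i : ℝ) : ℂ))
    (by
      refine measurable_pi_lambda _ fun i => Complex.measurable_ofReal.comp ?_
      refine Finset.measurable_prod _ fun j _ => ?_
      exact (measurable_pi_apply i).comp (hX.comp (measurable_pi_apply j)))
    (R := 1)
    (Eventually.of_forall fun y => (pi_norm_le_iff_of_nonneg zero_le_one).2 fun i => by
      rw [Complex.norm_real, Real.norm_of_nonneg (hX0' y i)]
      exact hX1' y i)
    (fun p q => by
      rw [← hprod (p + q), ← integral_fintype_prod_eq_prod]
      refine integral_congr_ae (Eventually.of_forall fun y => ?_)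
      simp only [Complex.conj_ofReal, ← pow_add]
      rw [Finset.prod_mul_distrib, Finset.prod_comm]
      congr 1
      refine Finset.prod_congr rfl fun i _ => ?_
      rw [Complex.ofReal_prod, Finset.prod_pow]
      rfl)
    -- A continuous function on all of `ℂⁿ` agreeing with the real power on the cube.
    ⟨fun z => ∏ i, ((max (z i).re 0 ^ v i : ℝ) : ℂ), by
      refine continuous_finsetProd _ fun i _ => Complex.continuous_ofReal.comp ?_
      refine (Real.continuous_rpow_const (hv i).le).comp ?_
      fun_prop⟩
  refine Finset.prod_ne_zero_iff.2 hne ?_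
  rw [← integral_fintype_prod_eq_prod, ← key]
  refine integral_congr_ae (Eventually.of_forall fun y => ?_)
  simp only [ContinuousMap.coe_mk, Complex.ofReal_re, max_eq_left (hX0' y _)]
  rw [Finset.prod_mul_distrib, Finset.prod_comm]
  congr 1
  refine Finset.prod_congr rfl fun i _ => ?_
  rw [← Complex.ofReal_prod, Real.finsetProd_rpow _ _ fun j _ => hX0 _ _]

/-! ### Leading terms of products of weighted shifts -/

/-- The span of the vectors `E γ` with `γ` bounded below by `L` and lexicographically smaller
than `δ`. -/
def lowerSpan {V : Type*} [AddCommGroup V] [Module ℂ V] {n : ℕ} (E : (Fin n → ℤ) → V) (L : ℤ)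
    (δ : Fin n → ℤ) : Submodule ℂ V :=
  Submodule.span ℂ (E '' {γ | (∀ i, L ≤ γ i) ∧ toLex γ < toLex δ})

theorem toLex_add_lt_add_right {n : ℕ} {a b : Fin n → ℤ} (h : toLex a < toLex b)
    (c : Fin n → ℤ) : toLex (a + c) < toLex (b + c) := by
  rw [toLex_add, toLex_add]
  exact add_lt_add_left h _

theorem toLex_add_lt_add_left {n : ℕ} {a b : Fin n → ℤ} (h : toLex a < toLex b)
    (c : Fin n → ℤ) : toLex (c + a) < toLex (c + b) := by
  rw [add_comm c, add_comm c]
  exact toLex_add_lt_add_right h c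

/-- The leading term of a product of finite sums of weighted shifts is the product of the leading
terms. -/
theorem exists_prod_apply_sub_mem_lowerSpan {V : Type*} [NormedAddCommGroup V] [NormedSpace ℂ V]
    {n : ℕ} (E : (Fin n → ℤ) → V) {b : ℤ} (hb0 : 0 ≤ b) {m : ℕ} (T : Fin m → V →L[ℂ] V)
    (K : Fin m → Finset (Fin n → ℤ)) (κ : Fin m → Fin n → ℤ)
    (c : Fin m → (Fin n → ℤ) → (Fin n → ℤ) → ℂ)
    (hb : ∀ j, ∀ k ∈ K j, ∀ i, -b ≤ k i) (hκ : ∀ j, κ j ∈ K j)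
    (hmax : ∀ j, ∀ k ∈ K j, k ≠ κ j → toLex k < toLex (κ j))
    (hT : ∀ j δ, (∀ i, b ≤ δ i) → T j (E δ) = ∑ k ∈ K j, c j k δ • E (δ + k)) :
    ∃ (s : Fin m → Fin n → ℤ) (S : Fin n → ℤ), ∀ L, 0 ≤ L → ∀ δ,
      ((∀ i, L + m * b ≤ δ i) → (List.ofFn T).reverse.prod (E δ) -
        (∏ j, c j (κ j) (δ + s j)) • E (δ + S) ∈ lowerSpan E L (δ + S)) ∧
      ∀ v ∈ lowerSpan E (L + m * b) δ, (List.ofFn T).reverse.prod v ∈ lowerSpan E L (δ + S) := by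
  -- The two claims go together: the tail is applied both to the leading term of `T 0 (E δ)` and to
  -- its lower terms. Unwinding, `s j` is the sum of the `κ i` with `i < j`, and `S` is the sum of
  -- all of them.
  induction m with
  | zero =>
    refine ⟨0, 0, fun L _ δ => ⟨fun _ => by simp, fun v hv => ?_⟩⟩
    simpa using hv
  | succ m ih =>
    obtain ⟨s, S, h⟩ := ih (fun j => T j.succ) (fun j => K j.succ) (fun j => κ j.succ)
      (fun j => c j.succ) (fun j => hb _) (fun j => hκ _) (fun j => hmax _) (fun j => hT _)
    have hprod : ∀ v, (List.ofFn T).reverse.prod v =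
        (List.ofFn fun j : Fin m => T j.succ).reverse.prod (T 0 v) := by
      intro v
      rw [List.ofFn_succ, List.reverse_cons, List.prod_append, List.prod_singleton]
      rfl
    -- One operator lowers a coordinate by at most `b`. Lexicographic order does not bound the
    -- coordinates, hence the separate bound `L`, which keeps degrees where `hT` applies.
    have hmem : ∀ L, 0 ≤ L → ∀ γ, (∀ i, L + b ≤ γ i) → ∀ k ∈ K 0, ∀ δ,
        toLex (γ + k) < toLex δ → E (γ + k) ∈ lowerSpan E L δ := by
      intro L _ γ hγ k hk δ hlt
      refine Submodule.subset_span ⟨_, ⟨fun i => ?_, hlt⟩, rfl⟩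
      have h1 := hγ i
      have h2 := hb 0 k hk i
      simp only [Pi.add_apply]
      linarith
    have hle : ∀ k ∈ K 0, toLex k ≤ toLex (κ 0) := fun k hk => by
      by_cases hk' : k = κ 0
      · rw [hk']
      · exact (hmax 0 k hk hk').le
    refine ⟨Fin.cons 0 fun j => κ 0 + s j, κ 0 + S, fun L hL δ => ?_⟩
    have hmb : 0 ≤ (m : ℤ) * b := by positivity
    have hL' : L + ((m + 1 : ℕ) : ℤ) * b = L + m * b + b := by push_cast; ring
    rw [hL', ← add_assoc]
    constructor
    · intro hδ
      have h0 : T 0 (E δ) = c 0 (κ 0) δ • E (δ + κ 0) +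
          ∑ k ∈ (K 0).erase (κ 0), c 0 k δ • E (δ + k) := by
        rw [hT 0 δ fun i => by linarith [hδ i]]
        exact (Finset.add_sum_erase _ _ (hκ 0)).symm
      have hrest : ∑ k ∈ (K 0).erase (κ 0), c 0 k δ • E (δ + k) ∈
          lowerSpan E (L + m * b) (δ + κ 0) := by
        refine Submodule.sum_mem _ fun k hk => Submodule.smul_mem _ _ ?_
        obtain ⟨hk1, hk2⟩ := Finset.mem_erase.1 hk
        exact hmem _ (by linarith) δ hδ k hk2 _ (toLex_add_lt_add_left (hmax 0 k hk2 hk1) δ)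
      have h1 := (h L hL (δ + κ 0)).1 fun i => by
        have h1 := hδ i
        have h2 := hb 0 _ (hκ 0) i
        simp only [Pi.add_apply]
        linarith
      have h2 := (h L hL (δ + κ 0)).2 _ hrest
      rw [hprod, h0, map_add, map_smul, Fin.prod_univ_succ, Fin.cons_zero, add_zero]
      simp only [Fin.cons_succ, ← add_assoc]
      convert Submodule.add_mem _ (Submodule.smul_mem _ (c 0 (κ 0) δ) h1) h2 using 1
      rw [smul_sub, smul_smul]
      abel
    · intro v hv
      rw [hprod]
      refine (h L hL (δ + κ 0)).2 _ ?_
      unfold lowerSpan at hv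
      induction hv using Submodule.span_induction with
      | mem x hx =>
        obtain ⟨γ, ⟨hγ, hlt⟩, rfl⟩ := hx
        rw [hT 0 γ fun i => by linarith [hγ i]]
        refine Submodule.sum_mem _ fun k hk => Submodule.smul_mem _ _ ?_
        refine hmem _ (by linarith) γ hγ k hk _ ((toLex_add_lt_add_right hlt k).trans_le ?_)
        rw [toLex_add, toLex_add]
        exact add_le_add_right (hle k hk) _
      | zero => rw [map_zero]; exact Submodule.zero_mem _
      | add x y _ _ hx hy => rw [map_add]; exact Submodule.add_mem _ hx hy
      | smul a x _ hx => rw [map_smul]; exact Submodule.smul_mem _ _ hx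

/-! ### Torus action and weights -/

/-- The rotation `(z₁, …, zₙ) ↦ (e^{iθ₁} z₁, …, e^{iθₙ} zₙ)`. -/
noncomputable def rot {n : ℕ} (θ : Fin n → ℝ) (z : Fin n → ℂ) : Fin n → ℂ :=
  fun j => Complex.exp (θ j * Complex.I) * z j

/-- The character `θ ↦ e^{i (k₁ θ₁ + ⋯ + kₙ θₙ)}` of the torus. -/
noncomputable def torusChar {n : ℕ} (k : Fin n → ℤ) (θ : Fin n → ℝ) : ℂ :=
  Complex.exp ((∑ j, (k j : ℂ) * (θ j : ℂ)) * Complex.I)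

theorem torusChar_ne_zero {n : ℕ} (k : Fin n → ℤ) (θ : Fin n → ℝ) : torusChar k θ ≠ 0 :=
  Complex.exp_ne_zero _

theorem torusChar_add {n : ℕ} (k l : Fin n → ℤ) (θ : Fin n → ℝ) :
    torusChar (k + l) θ = torusChar k θ * torusChar l θ := by
  rw [torusChar, torusChar, torusChar, ← Complex.exp_add, ← add_mul, ← Finset.sum_add_distrib]
  simp [add_mul]

theorem conj_torusChar {n : ℕ} (k : Fin n → ℤ) (θ : Fin n → ℝ) :
    (starRingEnd ℂ) (torusChar k θ) = torusChar (-k) θ := by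
  rw [torusChar, torusChar, ← Complex.exp_conj]
  simp [map_sum]

theorem exists_torusChar_ne_one {n : ℕ} {k : Fin n → ℤ} (hk : k ≠ 0) :
    ∃ θ : Fin n → ℝ, torusChar k θ ≠ 1 := by
  obtain ⟨i, hi⟩ := Function.ne_iff.1 hk
  have hi' : (k i : ℂ) ≠ 0 := Int.cast_ne_zero.2 hi
  -- The angle is chosen so that the character takes the value `-1`.
  refine ⟨Pi.single i (Real.pi / k i), ?_⟩
  have : ∑ j, (k j : ℂ) * ((Pi.single i (Real.pi / k i) : Fin n → ℝ) j : ℂ) = Real.pi := by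
    rw [Finset.sum_eq_single i]
    · rw [Pi.single_eq_same]
      push_cast
      field_simp
    · intro j _ hj
      simp [hj]
    · simp
  rw [torusChar, this, Complex.exp_pi_mul_I]
  norm_num

theorem rot_rot_neg {n : ℕ} (θ : Fin n → ℝ) (z : Fin n → ℂ) : rot θ (rot (-θ) z) = z := by
  ext j
  simp [rot, ← mul_assoc, ← Complex.exp_add]

theorem rot_neg_rot {n : ℕ} (θ : Fin n → ℝ) (z : Fin n → ℂ) : rot (-θ) (rot θ z) = z := by
  ext j
  simp [rot, ← mul_assoc, ← Complex.exp_add]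

theorem IsReinhardt.rot_mem {n : ℕ} {Ω : Set (Fin n → ℂ)} (h : IsReinhardt Ω) (θ : Fin n → ℝ)
    {z : Fin n → ℂ} (hz : z ∈ Ω) : rot θ z ∈ Ω := h z hz θ

theorem IsReinhardt.preimage_rot {n : ℕ} {Ω : Set (Fin n → ℂ)} (h : IsReinhardt Ω)
    (θ : Fin n → ℝ) : rot θ ⁻¹' Ω = Ω := by
  ext z
  refine ⟨fun hz => ?_, fun hz => h.rot_mem θ hz⟩
  rw [← rot_neg_rot θ z]
  exact h.rot_mem _ hz

theorem continuous_rot {n : ℕ} (θ : Fin n → ℝ) : Continuous (rot θ) := by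
  unfold rot
  fun_prop

theorem measurePreserving_rot {n : ℕ} {Ω : Set (Fin n → ℂ)} (h : IsReinhardt Ω)
    (hm : MeasurableSet Ω) (θ : Fin n → ℝ) :
    MeasurePreserving (rot θ) (volume.restrict Ω) (volume.restrict Ω) := by
  have hmp : MeasurePreserving (rot θ) (volume : Measure (Fin n → ℂ)) volume := by
    refine volume_preserving_pi (f := fun j (x : ℂ) => Complex.exp (θ j * Complex.I) * x)
      fun j => ?_
    exact (rotation (⟨Complex.exp (θ j * Complex.I), by
      simp [Submonoid.unitSphere, Complex.norm_exp_ofReal_mul_I]⟩ : Circle)).measurePreserving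
  have := hmp.restrict_preimage hm
  rwa [h.preimage_rot θ] at this

/-- `f` transforms under rotations by the character of weight `k`, almost everywhere on `Ω`. -/
def HasWeight {n : ℕ} (Ω : Set (Fin n → ℂ)) (k : Fin n → ℤ) (f : (Fin n → ℂ) → ℂ) : Prop :=
  ∀ θ, (fun z => f (rot θ z)) =ᵐ[volume.restrict Ω] fun z => torusChar k θ * f z

namespace HasWeight

variable {n : ℕ} {Ω : Set (Fin n → ℂ)} {k l : Fin n → ℤ} {f g : (Fin n → ℂ) → ℂ}

theorem congr_ae (h : IsReinhardt Ω) (hm : MeasurableSet Ω) (hf : HasWeight Ω k f)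
    (hfg : f =ᵐ[volume.restrict Ω] g) : HasWeight Ω k g := by
  intro θ
  filter_upwards [hf θ, hfg,
    (measurePreserving_rot h hm θ).quasiMeasurePreserving.ae_eq_comp hfg] with z h1 h2 h3
  simp only [Function.comp_apply] at h3
  rw [← h3, h1, h2]

theorem mul (hf : HasWeight Ω k f) (hg : HasWeight Ω l g) :
    HasWeight Ω (k + l) fun z => f z * g z := by
  intro θ
  filter_upwards [hf θ, hg θ] with z h1 h2
  rw [h1, h2, torusChar_add]
  ring

theorem add (hf : HasWeight Ω k f) (hg : HasWeight Ω k g) :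
    HasWeight Ω k fun z => f z + g z := by
  intro θ
  filter_upwards [hf θ, hg θ] with z h1 h2
  rw [h1, h2]
  ring

theorem zero : HasWeight Ω k fun _ => 0 := fun _ => by simp

theorem conj (hf : HasWeight Ω k f) : HasWeight Ω (-k) fun z => (starRingEnd ℂ) (f z) := by
  intro θ
  filter_upwards [hf θ] with z h1
  rw [h1, map_mul, conj_torusChar]

/-- Rotation preserves the integral but multiplies it by a character value, which can be chosen
different from `1`. -/
theorem integral_eq_zero (h : IsReinhardt Ω) (hm : MeasurableSet Ω) (hf : HasWeight Ω k f)
    (hk : k ≠ 0) : ∫ z in Ω, f z = 0 := by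
  obtain ⟨θ, hθ⟩ := exists_torusChar_ne_one hk
  have hemb : MeasurableEmbedding (rot θ) := by
    refine (MeasurableEquiv.measurableEmbedding ⟨⟨rot θ, rot (-θ), rot_neg_rot θ, rot_rot_neg θ⟩,
      (continuous_rot θ).measurable, (continuous_rot (-θ)).measurable⟩)
  have h1 := (measurePreserving_rot h hm θ).integral_comp hemb f
  rw [integral_congr_ae (hf θ), integral_const_mul] at h1
  have h2 : (torusChar k θ - 1) * ∫ z in Ω, f z = 0 := by rw [sub_mul, h1, one_mul, sub_self]
  exact (mul_eq_zero.1 h2).resolve_left (sub_ne_zero.2 hθ)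

end HasWeight

/-! ### Monomials and holomorphic functions of given weight -/

/-- The monomial `z ↦ ∏ⱼ zⱼ ^ δⱼ` (negative exponents are replaced by `0`). -/
noncomputable def monomialFun {n : ℕ} (δ : Fin n → ℤ) (z : Fin n → ℂ) : ℂ :=
  ∏ j, z j ^ (δ j).toNat

theorem continuous_monomialFun {n : ℕ} (δ : Fin n → ℤ) : Continuous (monomialFun δ) := by
  unfold monomialFun
  fun_prop

theorem differentiable_monomialFun {n : ℕ} (δ : Fin n → ℤ) :
    Differentiable ℂ (monomialFun δ) := by
  unfold monomialFun
  fun_prop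

theorem monomialFun_rot {n : ℕ} {δ : Fin n → ℤ} (hδ : ∀ i, 0 ≤ δ i) (θ : Fin n → ℝ)
    (z : Fin n → ℂ) : monomialFun δ (rot θ z) = torusChar δ θ * monomialFun δ z := by
  simp only [monomialFun, rot, torusChar, mul_pow, Finset.prod_mul_distrib, Finset.sum_mul,
    Complex.exp_sum, ← Complex.exp_nat_mul]
  congr 1
  refine Finset.prod_congr rfl fun j _ => ?_
  congr 1
  have : ((δ j).toNat : ℂ) = (δ j : ℂ) := by
    rw [← Int.cast_natCast, Int.toNat_of_nonneg (hδ j)]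
  rw [this, mul_assoc]

theorem hasWeight_monomialFun {n : ℕ} (Ω : Set (Fin n → ℂ)) {δ : Fin n → ℤ} (hδ : ∀ i, 0 ≤ δ i) :
    HasWeight Ω δ (monomialFun δ) :=
  fun θ => Eventually.of_forall fun z => monomialFun_rot hδ θ z

theorem ae_coord_ne_zero (n : ℕ) : ∀ᵐ z : Fin n → ℂ, ∀ i, z i ≠ 0 := by
  rw [ae_all_iff]
  intro i
  exact Measure.ae_eval_ne (fun _ : Fin n => volume) i 0

theorem monomialFun_ne_zero {n : ℕ} (δ : Fin n → ℤ) {z : Fin n → ℂ} (hz : ∀ i, z i ≠ 0) :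
    monomialFun δ z ≠ 0 :=
  Finset.prod_ne_zero_iff.2 fun i _ => pow_ne_zero _ (hz i)

/-- A holomorphic function on a connected open set which vanishes near one point vanishes
identically. -/
theorem eqOn_zero_of_eventuallyEq_zero {n : ℕ} {Ω : Set (Fin n → ℂ)} (hΩ : IsOpen Ω)
    (hc : IsPreconnected Ω) {g : (Fin n → ℂ) → ℂ} (hg : DifferentiableOn ℂ g Ω)
    {p : Fin n → ℂ} (hp : p ∈ Ω) (hgp : g =ᶠ[𝓝 p] 0) : ∀ z ∈ Ω, g z = 0 := by
  -- The set where `g` vanishes locally is open; it is relatively closed by the one-variable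
  -- identity theorem on the complex line from a nearby point `w` of the set to an arbitrary `v` in
  -- the ball.
  have hsub : Ω ⊆ {z | g =ᶠ[𝓝 z] 0} := by
    refine hc.subset_of_closure_inter_subset isOpen_setOfPred_eventually_nhds ⟨p, hp, hgp⟩ ?_
    rintro z ⟨hz, hzΩ⟩
    obtain ⟨R, hR, hball⟩ := Metric.isOpen_iff.1 hΩ z hzΩ
    obtain ⟨w, hw, hzw⟩ := Metric.mem_closure_iff.1 hz R hR
    have hwball : w ∈ Metric.ball z R := by rwa [Metric.mem_ball, dist_comm]
    refine Filter.eventually_of_mem (Metric.ball_mem_nhds z hR) fun v hv => ?_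
    let l : ℂ → Fin n → ℂ := fun t => w + t • (v - w)
    have hl : Continuous l := by fun_prop
    have hUo : IsOpen (l ⁻¹' Metric.ball z R) := Metric.isOpen_ball.preimage hl
    have hUc : IsPreconnected (l ⁻¹' Metric.ball z R) := by
      refine Convex.isPreconnected fun s hs t ht a b ha hb hab => ?_
      have h1 := convex_ball z R hs ht ha hb hab
      have h2 : a • l s + b • l t = l (a • s + b • t) := by
        have hab' : (a : ℂ) + b = 1 := by exact_mod_cast hab
        ext i
        simp only [l, Pi.add_apply, Pi.smul_apply, Complex.real_smul, smul_eq_mul, Pi.sub_apply]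
        linear_combination (w i) * hab'
      rwa [h2] at h1
    have hd : DifferentiableOn ℂ (fun t => g (l t)) (l ⁻¹' Metric.ball z R) :=
      (hg.mono hball).comp (Differentiable.differentiableOn (by fun_prop)) fun t ht => ht
    have hev : (fun t => g (l t)) =ᶠ[𝓝 0] 0 := by
      have : Tendsto l (𝓝 0) (𝓝 w) := hl.tendsto' _ _ (by simp [l])
      exact this.eventually hw
    have := (hd.analyticOnNhd hUo).eqOn_zero_of_preconnected_of_eventuallyEq_zero hUc
      (z₀ := 0) (by simpa [l] using hwball) hev (x := 1) (by simpa [l] using hv)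
    simpa [l] using this
  exact fun z hz => (hsub hz).eq_of_nhds

/-- A holomorphic function on a Reinhardt domain of weight `δ ∈ ℕⁿ` is a multiple of `z ^ δ`. -/
theorem exists_eq_const_mul_monomialFun {n : ℕ} {Ω : Set (Fin n → ℂ)} (hΩ : IsOpen Ω)
    (hc : IsConnected Ω) {δ : Fin n → ℤ} (hδ : ∀ i, 0 ≤ δ i)
    {g : (Fin n → ℂ) → ℂ} (hg : DifferentiableOn ℂ g Ω)
    (hgw : ∀ θ, ∀ z ∈ Ω, g (rot θ z) = torusChar δ θ * g z) :
    ∃ c : ℂ, ∀ z ∈ Ω, g z = c * monomialFun δ z := by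
  obtain ⟨p, hpΩ, hp⟩ : ∃ p ∈ Ω, ∀ i, p i ≠ 0 := by
    have h1 : (volume.restrict Ω) ≠ 0 := by
      rw [Ne, Measure.restrict_eq_zero]
      exact (hΩ.measure_pos volume hc.nonempty).ne'
    have : (ae (volume.restrict Ω)).NeBot := ae_neBot.2 h1
    exact ((ae_restrict_mem hΩ.measurableSet).and
      (ae_restrict_of_ae (ae_coord_ne_zero n))).exists
  -- Near a point off the coordinate hyperplanes, `q` is holomorphic and rotation invariant. Its
  -- derivative kills the orbit directions `i z_j e_j`, which span `ℂⁿ` over `ℂ`, so `q` is locally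
  -- constant; the identity theorem extends the result to `Ω`.
  set q : (Fin n → ℂ) → ℂ := fun z => g z * (monomialFun δ z)⁻¹ with hq
  have hVo : IsOpen (Ω ∩ {z | ∀ i, z i ≠ 0}) := by
    refine hΩ.inter ?_
    rw [Set.ofPred_forall]
    exact isOpen_iInter_of_finite fun i => isOpen_ne_fun (by fun_prop) continuous_const
  obtain ⟨R, hR, hball⟩ := Metric.isOpen_iff.1 hVo p ⟨hpΩ, hp⟩
  have hqd : DifferentiableOn ℂ q (Metric.ball p R) := by
    refine (hg.mono fun z hz => (hball hz).1).mul
      ((differentiable_monomialFun δ).differentiableOn.fun_inv fun z hz => ?_)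
    exact monomialFun_ne_zero δ (hball hz).2
  have hqw : ∀ θ, ∀ z ∈ Metric.ball p R, q (rot θ z) = q z := by
    intro θ z hz
    have h1 := torusChar_ne_zero δ θ
    have h2 := monomialFun_ne_zero δ (hball hz).2
    rw [hq]
    simp only
    rw [hgw θ z (hball hz).1, monomialFun_rot hδ]
    field_simp
  have hfd : ∀ z ∈ Metric.ball p R, fderiv ℂ q z = 0 := by
    intro z hz
    have hqz : HasFDerivAt q (fderiv ℂ q z) z :=
      (hqd.differentiableAt (Metric.isOpen_ball.mem_nhds hz)).hasFDerivAt
    have hdir : ∀ j, fderiv ℂ q z (Pi.single j (Complex.I * z j)) = 0 := by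
      intro j
      have hrot : HasDerivAt (fun t : ℝ => rot (Pi.single j t) z)
          (Pi.single j (Complex.I * z j)) 0 := by
        rw [hasDerivAt_pi]
        intro i
        by_cases hij : i = j
        · subst hij
          simp only [rot, Pi.single_eq_same]
          have h1 : HasDerivAt (fun t : ℝ => (t : ℂ) * Complex.I) Complex.I 0 := by
            simpa using (Complex.ofRealCLM.hasDerivAt (x := (0 : ℝ))).mul_const Complex.I
          simpa using (h1.cexp).mul_const (z i)
        · simp only [rot, Pi.single_eq_of_ne hij]
          exact hasDerivAt_const _ _
      have h0 : rot (Pi.single j (0 : ℝ)) z = z := by ext; simp [rot]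
      have h1 : HasDerivAt (fun t : ℝ => q (rot (Pi.single j t) z))
          (fderiv ℂ q z (Pi.single j (Complex.I * z j))) 0 :=
        HasFDerivAt.comp_hasDerivAt (l := q) (l' := (fderiv ℂ q z).restrictScalars ℝ) (0 : ℝ)
          (by rw [h0]; exact hqz.restrictScalars ℝ) hrot
      have h2 : (fun t : ℝ => q (rot (Pi.single j t) z)) = fun _ => q z :=
        funext fun t => hqw _ z hz
      rw [h2] at h1
      exact h1.unique (hasDerivAt_const _ _)
    refine ContinuousLinearMap.coe_injective (LinearMap.pi_ext fun j x => ?_)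
    have hzj : Complex.I * z j ≠ 0 := mul_ne_zero Complex.I_ne_zero ((hball hz).2 j)
    have : (Pi.single j x : Fin n → ℂ) =
        (x / (Complex.I * z j)) • Pi.single j (Complex.I * z j) := by
      rw [← Pi.single_smul, smul_eq_mul, div_mul_cancel₀ _ hzj]
    rw [this]
    simp only [ContinuousLinearMap.coe_coe, map_smul, hdir j]
    simp
  have hconst : ∀ z ∈ Metric.ball p R, q z = q p := fun z hz =>
    Metric.isOpen_ball.is_const_of_fderiv_eq_zero (convex_ball p R).isPreconnected hqd hfd hz
      (Metric.mem_ball_self hR)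
  refine ⟨q p, fun z hz => ?_⟩
  refine sub_eq_zero.1 (eqOn_zero_of_eventuallyEq_zero hΩ hc.isPreconnected
    (hg.sub ((differentiable_monomialFun δ).differentiableOn.const_mul (q p))) hpΩ ?_ z hz)
  filter_upwards [Metric.ball_mem_nhds p hR] with w hw
  have h1 := hconst w hw
  rw [← h1]
  simp [hq, monomialFun_ne_zero δ (hball hw).2]

theorem exists_norm_le_of_isBounded {n : ℕ} {Ω : Set (Fin n → ℂ)} (hb : Bornology.IsBounded Ω)
    {f : (Fin n → ℂ) → ℂ} (hf : Continuous f) : ∃ C, ∀ z ∈ Ω, ‖f z‖ ≤ C := by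
  obtain ⟨C, hC⟩ := hb.isCompact_closure.exists_bound_of_continuousOn hf.continuousOn
  exact ⟨C, fun z hz => hC z (subset_closure hz)⟩

theorem isFiniteMeasure_restrict_of_isBounded {n : ℕ} {Ω : Set (Fin n → ℂ)}
    (hb : Bornology.IsBounded Ω) : IsFiniteMeasure (volume.restrict Ω) :=
  isFiniteMeasure_restrict.2 hb.measure_lt_top.ne

theorem memLp_of_continuous {n : ℕ} {Ω : Set (Fin n → ℂ)} (hb : Bornology.IsBounded Ω)
    (hm : MeasurableSet Ω) {f : (Fin n → ℂ) → ℂ} (hf : Continuous f) (p : ℝ≥0∞) :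
    MemLp f p (volume.restrict Ω) := by
  have := isFiniteMeasure_restrict_of_isBounded hb
  obtain ⟨C, hC⟩ := exists_norm_le_of_isBounded hb hf
  exact MemLp.of_bound hf.aestronglyMeasurable C
    ((ae_restrict_mem hm).mono fun z hz => hC z hz)

/-! ### Toeplitz operators on monomials -/

/-- The monomial `z ^ δ` as an element of the Bergman space of a bounded domain. -/
noncomputable def monomialVec {n : ℕ} (Ω : TopologicalSpace.Opens (Fin n → ℂ))
    (hb : Bornology.IsBounded (Ω : Set (Fin n → ℂ))) (δ : Fin n → ℤ) : bergmanSpace Ω :=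
  ⟨(memLp_of_continuous hb Ω.isOpen.measurableSet (continuous_monomialFun δ) 2).toLp _,
    monomialFun δ, (differentiable_monomialFun δ).differentiableOn, MemLp.coeFn_toLp _⟩

theorem coeFn_monomialVec {n : ℕ} (Ω : TopologicalSpace.Opens (Fin n → ℂ))
    (hb : Bornology.IsBounded (Ω : Set (Fin n → ℂ))) (δ : Fin n → ℤ) :
    (monomialVec Ω hb δ : Lp ℂ 2 (volume.restrict (Ω : Set (Fin n → ℂ)))) =ᵐ[volume.restrict
      (Ω : Set (Fin n → ℂ))] monomialFun δ :=
  (memLp_of_continuous hb Ω.isOpen.measurableSet (continuous_monomialFun δ) 2).coeFn_toLp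

theorem ae_restrict_neBot {n : ℕ} {Ω : TopologicalSpace.Opens (Fin n → ℂ)}
    (hne : (Ω : Set (Fin n → ℂ)).Nonempty) :
    (ae (volume.restrict (Ω : Set (Fin n → ℂ)))).NeBot := by
  rw [ae_neBot, Ne, Measure.restrict_eq_zero]
  exact (Ω.isOpen.measure_pos volume hne).ne'

theorem monomialVec_ne_zero {n : ℕ} {Ω : TopologicalSpace.Opens (Fin n → ℂ)}
    (hne : (Ω : Set (Fin n → ℂ)).Nonempty)
    (hb : Bornology.IsBounded (Ω : Set (Fin n → ℂ))) (δ : Fin n → ℤ) :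
    monomialVec Ω hb δ ≠ 0 := by
  intro h0
  have := ae_restrict_neBot hne
  have h1 := coeFn_monomialVec Ω hb δ
  rw [h0] at h1
  obtain ⟨z, h2, h3, h4⟩ := (h1.and ((Lp.coeFn_zero ℂ 2 _).and
    (ae_restrict_of_ae (ae_coord_ne_zero n)))).exists
  exact monomialFun_ne_zero δ h4 (h2.symm.trans h3)

/-- Monomials of different degrees are orthogonal. -/
theorem inner_monomialVec_eq_zero {n : ℕ} {Ω : TopologicalSpace.Opens (Fin n → ℂ)}
    (hb : Bornology.IsBounded (Ω : Set (Fin n → ℂ)))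
    (hrein : IsReinhardt (Ω : Set (Fin n → ℂ))) {γ δ : Fin n → ℤ} (hγ : ∀ i, 0 ≤ γ i)
    (hδ : ∀ i, 0 ≤ δ i) (hne : γ ≠ δ) :
    inner ℂ (monomialVec Ω hb γ) (monomialVec Ω hb δ) = 0 := by
  rw [Submodule.coe_inner, L2.inner_def]
  have hw := (hasWeight_monomialFun (Ω : Set (Fin n → ℂ)) hδ).mul
    (hasWeight_monomialFun (Ω : Set (Fin n → ℂ)) hγ).conj
  rw [← hw.integral_eq_zero hrein Ω.isOpen.measurableSet
    (by rw [← sub_eq_add_neg]; exact sub_ne_zero.2 hne.symm)]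
  refine integral_congr_ae ?_
  filter_upwards [coeFn_monomialVec Ω hb γ, coeFn_monomialVec Ω hb δ] with z h1 h2
  rw [h1, h2, RCLike.inner_apply]

/-- Composition with a rotation, as an isometry of `L²(Ω)`. -/
noncomputable abbrev rotIsometry {n : ℕ} {Ω : TopologicalSpace.Opens (Fin n → ℂ)}
    (hrein : IsReinhardt (Ω : Set (Fin n → ℂ))) (θ : Fin n → ℝ) :
    Lp ℂ 2 (volume.restrict (Ω : Set (Fin n → ℂ))) →ₗᵢ[ℂ]
      Lp ℂ 2 (volume.restrict (Ω : Set (Fin n → ℂ))) :=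
  Lp.compMeasurePreservingₗᵢ ℂ (rot θ) (measurePreserving_rot hrein Ω.isOpen.measurableSet θ)

/-- The orthogonal projection onto the Bergman space commutes with rotations. -/
theorem rotIsometry_orthogonalProjectionOnto {n : ℕ}
    {Ω : TopologicalSpace.Opens (Fin n → ℂ)} (hrein : IsReinhardt (Ω : Set (Fin n → ℂ)))
    (u : Lp ℂ 2 (volume.restrict (Ω : Set (Fin n → ℂ)))) (θ : Fin n → ℝ) :
    rotIsometry hrein θ ((bergmanSpace Ω).orthogonalProjectionOnto u) =
      (bergmanSpace Ω).orthogonalProjectionOnto (rotIsometry hrein θ u) := by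
  have mp := fun θ => measurePreserving_rot hrein Ω.isOpen.measurableSet θ
  have hmem : ∀ θ, ∀ v ∈ bergmanSpace Ω,
      rotIsometry hrein θ v ∈ bergmanSpace Ω := by
    rintro θ v ⟨g, hg, hvg⟩
    refine ⟨g ∘ rot θ, hg.comp (Differentiable.differentiableOn ?_)
      fun z hz => hrein.rot_mem θ hz, ?_⟩
    · unfold rot
      fun_prop
    · exact (Lp.coeFn_compMeasurePreserving v (mp θ)).trans
        ((mp θ).quasiMeasurePreserving.ae_eq_comp hvg)
  symm
  -- Rotations preserve `A²` and are invertible there, so being isometries they also preserve its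
  -- orthogonal complement.
  refine Submodule.eq_starProjection_of_mem_of_inner_eq_zero (hmem θ _ (Subtype.mem _)) ?_
  intro w hw
  have hinv : rotIsometry hrein θ
      (rotIsometry hrein (-θ) w) = w := by
    refine Lp.ext ?_
    refine (Lp.coeFn_compMeasurePreserving _ (mp θ)).trans ?_
    refine ((mp θ).quasiMeasurePreserving.ae_eq_comp
      (Lp.coeFn_compMeasurePreserving w (mp (-θ)))).trans (Eventually.of_forall fun z => ?_)
    simp [rot_neg_rot]
  rw [← hinv, ← map_sub, LinearIsometry.inner_map_map]
  exact Submodule.starProjection_inner_eq_zero u _ (hmem _ _ hw)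

/-- The projection of a function of weight `δ ∈ ℕⁿ` is a multiple of `z ^ δ`. -/
theorem exists_orthogonalProjection_eq_smul_monomialVec {n : ℕ}
    {Ω : TopologicalSpace.Opens (Fin n → ℂ)} (hconn : IsConnected (Ω : Set (Fin n → ℂ)))
    (hb : Bornology.IsBounded (Ω : Set (Fin n → ℂ)))
    (hrein : IsReinhardt (Ω : Set (Fin n → ℂ)))
    {u : Lp ℂ 2 (volume.restrict (Ω : Set (Fin n → ℂ)))} {δ : Fin n → ℤ} (hδ : ∀ i, 0 ≤ δ i)
    (hu : HasWeight (Ω : Set (Fin n → ℂ)) δ u) :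
    ∃ c : ℂ, (bergmanSpace Ω).orthogonalProjectionOnto u = c • monomialVec Ω hb δ := by
  set v := (bergmanSpace Ω).orthogonalProjectionOnto u with hv
  have mp := fun θ => measurePreserving_rot hrein Ω.isOpen.measurableSet θ
  obtain ⟨g, hg, hvg⟩ := v.2
  have hgw : ∀ θ, ∀ z ∈ (Ω : Set (Fin n → ℂ)), g (rot θ z) = torusChar δ θ * g z := by
    intro θ
    have hRu : rotIsometry hrein θ u = torusChar δ θ • u := by
      refine Lp.ext ?_
      refine (Lp.coeFn_compMeasurePreserving _ (mp θ)).trans ((hu θ).trans ?_)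
      exact (Lp.coeFn_smul (torusChar δ θ) u).symm
    have hRv := rotIsometry_orthogonalProjectionOnto hrein u θ
    rw [hRu, map_smul, ← hv] at hRv
    have hae : (fun z => g (rot θ z)) =ᵐ[volume.restrict (Ω : Set (Fin n → ℂ))]
        fun z => torusChar δ θ * g z := by
      have h1 := Lp.coeFn_compMeasurePreserving v.1 (mp θ)
      have h2 := (mp θ).quasiMeasurePreserving.ae_eq_comp hvg
      have h3 := Lp.coeFn_smul (torusChar δ θ) v.1
      have h4 : (Lp.compMeasurePreserving (rot θ) (mp θ)) v.1 =
          torusChar δ θ • v.1 := hRv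
      rw [h4] at h1
      filter_upwards [h1, h2, h3, hvg] with z h1 h2 h3 h5
      simp only [Function.comp_apply, Pi.smul_apply, smul_eq_mul] at h1 h2 h3
      rw [← h2, ← h1, h3, h5]
    -- Both sides are continuous, so equality almost everywhere on an open set holds everywhere.
    refine Measure.eqOn_open_of_ae_eq hae Ω.isOpen ?_ (continuousOn_const.mul hg.continuousOn)
    exact hg.continuousOn.comp (continuous_rot θ).continuousOn fun z hz => hrein.rot_mem θ hz
  obtain ⟨c, hc⟩ := exists_eq_const_mul_monomialFun Ω.isOpen hconn hδ hg hgw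
  refine ⟨c, Subtype.ext (Lp.ext ?_)⟩
  rw [Submodule.coe_smul]
  filter_upwards [hvg, Lp.coeFn_smul c (monomialVec Ω hb δ : Lp ℂ 2 _),
    coeFn_monomialVec Ω hb δ, ae_restrict_mem Ω.isOpen.measurableSet] with z h1 h2 h3 h4
  rw [h1, h2, hc z h4, Pi.smul_apply, h3, smul_eq_mul]

theorem coeFn_holderL_monomialVec {n : ℕ} {Ω : TopologicalSpace.Opens (Fin n → ℂ)}
    (hb : Bornology.IsBounded (Ω : Set (Fin n → ℂ)))
    (φ : Lp ℂ ∞ (volume.restrict (Ω : Set (Fin n → ℂ)))) (δ : Fin n → ℤ) :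
    (ContinuousLinearMap.mul ℂ ℂ).holderL (volume.restrict (Ω : Set (Fin n → ℂ))) ∞ 2 2 φ
        (monomialVec Ω hb δ : Lp ℂ 2 (volume.restrict (Ω : Set (Fin n → ℂ))))
      =ᵐ[volume.restrict (Ω : Set (Fin n → ℂ))] fun z => φ z * monomialFun δ z := by
  refine (ContinuousLinearMap.coeFn_holder _ _ _).trans ?_
  filter_upwards [coeFn_monomialVec Ω hb δ] with z hz
  rw [hz, ContinuousLinearMap.mul_apply']

/-- The matrix coefficients of a Toeplitz operator with respect to the monomials. -/
theorem inner_monomialVec_toeplitz {n : ℕ} {Ω : TopologicalSpace.Opens (Fin n → ℂ)}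
    (hb : Bornology.IsBounded (Ω : Set (Fin n → ℂ)))
    (φ : Lp ℂ ∞ (volume.restrict (Ω : Set (Fin n → ℂ)))) (γ δ : Fin n → ℤ) :
    inner ℂ (monomialVec Ω hb γ) (toeplitz Ω φ (monomialVec Ω hb δ)) =
      ∫ z in (Ω : Set (Fin n → ℂ)),
        φ z * monomialFun δ z * (starRingEnd ℂ) (monomialFun γ z) := by
  have h : inner ℂ (monomialVec Ω hb γ) (toeplitz Ω φ (monomialVec Ω hb δ)) =
      inner ℂ (monomialVec Ω hb γ : Lp ℂ 2 (volume.restrict (Ω : Set (Fin n → ℂ))))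
        ((ContinuousLinearMap.mul ℂ ℂ).holderL (volume.restrict (Ω : Set (Fin n → ℂ))) ∞ 2 2 φ
          (monomialVec Ω hb δ : Lp ℂ 2 (volume.restrict (Ω : Set (Fin n → ℂ))))) :=
    Submodule.inner_orthogonalProjectionOnto_eq_of_mem_left _ _
  rw [h, L2.inner_def]
  refine integral_congr_ae ?_
  filter_upwards [coeFn_monomialVec Ω hb γ, coeFn_holderL_monomialVec hb φ δ] with z h1 h2
  rw [h1, h2, RCLike.inner_apply]

/-- The function `φ z^δ` has weight `δ + k`, so its projection is a multiple of `z^(δ+k)`; pairing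
with `z^(δ+k)` identifies the factor. -/
theorem toeplitz_monomialVec {n : ℕ} {Ω : TopologicalSpace.Opens (Fin n → ℂ)}
    (hconn : IsConnected (Ω : Set (Fin n → ℂ)))
    (hb : Bornology.IsBounded (Ω : Set (Fin n → ℂ)))
    (hrein : IsReinhardt (Ω : Set (Fin n → ℂ)))
    {φ : Lp ℂ ∞ (volume.restrict (Ω : Set (Fin n → ℂ)))} {k δ : Fin n → ℤ}
    (hφ : HasWeight (Ω : Set (Fin n → ℂ)) k φ) (hδ : ∀ i, 0 ≤ δ i)
    (hδk : ∀ i, 0 ≤ (δ + k) i) :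
    toeplitz Ω φ (monomialVec Ω hb δ) =
      ((∫ z in (Ω : Set (Fin n → ℂ)),
          φ z * monomialFun δ z * (starRingEnd ℂ) (monomialFun (δ + k) z)) /
        inner ℂ (monomialVec Ω hb (δ + k)) (monomialVec Ω hb (δ + k))) •
        monomialVec Ω hb (δ + k) := by
  have hw := ((hφ.mul (hasWeight_monomialFun _ hδ)).congr_ae hrein Ω.isOpen.measurableSet
    (coeFn_holderL_monomialVec hb φ δ).symm)
  rw [add_comm] at hw
  obtain ⟨c, hc⟩ := exists_orthogonalProjection_eq_smul_monomialVec hconn hb hrein hδk hw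
  have hc' : toeplitz Ω φ (monomialVec Ω hb δ) = c • monomialVec Ω hb (δ + k) := hc
  have hinner : inner ℂ (monomialVec Ω hb (δ + k)) (c • monomialVec Ω hb (δ + k)) =
      c * inner ℂ (monomialVec Ω hb (δ + k)) (monomialVec Ω hb (δ + k)) := by
    rw [Submodule.coe_inner, Submodule.coe_smul, inner_smul_right, Submodule.coe_inner]
  rw [← inner_monomialVec_toeplitz hb, hc', hinner, mul_div_cancel_right₀]
  exact inner_self_ne_zero.2 (monomialVec_ne_zero hconn.nonempty hb _)

theorem toeplitz_sum {n : ℕ} (Ω : TopologicalSpace.Opens (Fin n → ℂ)) {ι : Type*} (S : Finset ι)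
    (φ : ι → Lp ℂ ∞ (volume.restrict (Ω : Set (Fin n → ℂ)))) (u : bergmanSpace Ω) :
    toeplitz Ω (∑ k ∈ S, φ k) u = ∑ k ∈ S, toeplitz Ω (φ k) u := by
  simp [toeplitz, map_sum]

/-! ### Weight decomposition of symbols -/

/-- In polar coordinates a rotation only adds `θ` to the arguments; the defining formula at both
sets of angles gives the character as quotient. -/
theorem IsQuasiHomogeneousOn.exists_hasWeight {n : ℕ} {Ω : Set (Fin n → ℂ)} (hm : MeasurableSet Ω)
    (hrein : IsReinhardt Ω) {ψ : (Fin n → ℂ) → ℂ} (h : IsQuasiHomogeneousOn Ω ψ) :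
    ∃ k, HasWeight Ω k ψ := by
  obtain ⟨f, k, hf⟩ := h
  refine ⟨k, fun θ => ?_⟩
  filter_upwards [ae_restrict_mem hm] with z hz
  have hpol : ∀ t : Fin n → ℝ, (fun j => (((‖z j‖₊ : ℝ≥0) : ℝ) : ℂ) *
      Complex.exp (((fun j => t j + (z j).arg) j : ℝ) * Complex.I)) = rot t z := by
    intro t
    ext j
    simp only [rot, coe_nnnorm]
    conv_rhs => rw [← Complex.norm_mul_exp_arg_mul_I (z j)]
    rw [Complex.ofReal_add, add_mul, Complex.exp_add]
    ring
  have h0 : rot 0 z = z := by ext; simp [rot]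
  have h1 := hf (fun j => ‖z j‖₊) (fun j => θ j + (z j).arg)
    (by rw [hpol]; exact hrein.rot_mem θ hz)
  have h2 := hf (fun j => ‖z j‖₊) (fun j => (0 : Fin n → ℝ) j + (z j).arg)
    (by rw [hpol, h0]; exact hz)
  rw [hpol] at h1 h2
  rw [h0] at h2
  rw [h1, h2, torusChar, mul_left_comm, ← Complex.exp_add, ← add_mul, ← Finset.sum_add_distrib]
  simp [mul_add]

theorem HasWeight.lp_sum {n : ℕ} {Ω : Set (Fin n → ℂ)} (hm : MeasurableSet Ω)
    (hrein : IsReinhardt Ω) {k : Fin n → ℤ} {ι : Type*} (S : Finset ι)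
    (ψ : ι → Lp ℂ ∞ (volume.restrict Ω)) (h : ∀ i ∈ S, HasWeight Ω k (ψ i)) :
    HasWeight Ω k (∑ i ∈ S, ψ i : Lp ℂ ∞ (volume.restrict Ω)) := by
  classical
  induction S using Finset.induction_on with
  | empty => exact HasWeight.zero.congr_ae hrein hm (Lp.coeFn_zero ℂ ∞ _).symm
  | insert a S ha ih =>
    rw [Finset.sum_insert ha]
    exact ((h a (Finset.mem_insert_self _ _)).add
      (ih fun i hi => h i (Finset.mem_insert_of_mem hi))).congr_ae hrein hm (Lp.coeFn_add _ _).symm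

/-- A finite sum of quasi-homogeneous functions is a sum of nonzero functions of distinct
weights. -/
theorem IsFiniteSumQuasiHomogeneous.exists_decomposition {n : ℕ} {Ω : Set (Fin n → ℂ)}
    (hm : MeasurableSet Ω) (hrein : IsReinhardt Ω) {φ : Lp ℂ ∞ (volume.restrict Ω)}
    (hφ : IsFiniteSumQuasiHomogeneous φ) :
    ∃ (K : Finset (Fin n → ℤ)) (Φ : (Fin n → ℤ) → Lp ℂ ∞ (volume.restrict Ω)),
      (∀ k, HasWeight Ω k (Φ k)) ∧ (∀ k ∈ K, Φ k ≠ 0) ∧ φ = ∑ k ∈ K, Φ k := by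
  classical
  obtain ⟨N, ψ, hψ, rfl⟩ := hφ
  have hw : ∀ i, ∃ k, HasWeight Ω k (ψ i) := by
    intro i
    obtain ⟨ψ₀, h1, h2⟩ := hψ i
    obtain ⟨k, hk⟩ := h1.exists_hasWeight hm hrein
    exact ⟨k, hk.congr_ae hrein hm h2.symm⟩
  choose κ hκ using hw
  let Φ : (Fin n → ℤ) → Lp ℂ ∞ (volume.restrict Ω) := fun k => ∑ i with κ i = k, ψ i
  -- Summands of equal weight may cancel; such weights are dropped so that a leading component is
  -- never zero.
  refine ⟨(Finset.univ.image κ).filter fun k => Φ k ≠ 0, Φ, fun k => ?_, fun k hk => ?_, ?_⟩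
  · refine HasWeight.lp_sum hm hrein _ _ fun i hi => ?_
    rw [← (Finset.mem_filter.1 hi).2]
    exact hκ i
  · exact (Finset.mem_filter.1 hk).2
  · rw [Finset.sum_filter_ne_zero]
    exact (Finset.sum_fiberwise_of_maps_to
      (fun i _ => Finset.mem_image_of_mem κ (Finset.mem_univ i)) _).symm

/-! ### Symbols of given weight and their moments -/

theorem monomialFun_natCast_add {n : ℕ} (a : Fin n → ℕ) {γ : Fin n → ℤ} (hγ : ∀ i, 0 ≤ γ i)
    (z : Fin n → ℂ) :
    monomialFun (fun i => (a i : ℤ) + γ i) z = (∏ i, z i ^ a i) * monomialFun γ z := by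
  rw [monomialFun, monomialFun, ← Finset.prod_mul_distrib]
  refine Finset.prod_congr rfl fun i _ => ?_
  rw [← pow_add, Int.toNat_add (by positivity) (hγ i), Int.toNat_natCast]

/-- A bounded function of weight `k` is determined by its moments. -/
theorem eq_zero_of_moments_eq_zero {n : ℕ} {Ω : Set (Fin n → ℂ)} (hm : MeasurableSet Ω)
    (hb : Bornology.IsBounded Ω) (hrein : IsReinhardt Ω) {φ : Lp ℂ ∞ (volume.restrict Ω)}
    {k γ : Fin n → ℤ} (hφ : HasWeight Ω k φ) (hγ : ∀ i, 0 ≤ γ i) (hγk : ∀ i, 0 ≤ (γ + k) i)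
    (hmom : ∀ a : Fin n → ℕ, ∫ z in Ω,
      φ z * monomialFun γ z * (starRingEnd ℂ) (monomialFun (γ + k) z) *
        ∏ i, (z i * (starRingEnd ℂ) (z i)) ^ (a i + 1) = 0) : φ = 0 := by
  have := isFiniteMeasure_restrict_of_isBounded hb
  -- The monomial factors bring `φ` to weight zero; the extra product of the `|z_i|²` accounts for
  -- the exponents `a i + 1` in `hmom`.
  set G : (Fin n → ℂ) → ℂ := fun z => monomialFun γ z * (starRingEnd ℂ) (monomialFun (γ + k) z) *
    ∏ i, (z i * (starRingEnd ℂ) (z i)) with hG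
  have hGc : Continuous G := by
    have h1 := continuous_monomialFun γ
    have h2 := continuous_monomialFun (γ + k)
    have h3 := Complex.continuous_conj
    exact (h1.mul (h3.comp h2)).mul (continuous_finsetProd _ fun i _ =>
      (continuous_apply i).mul (h3.comp (continuous_apply i)))
  have hHint : Integrable (fun z => φ z * G z) (volume.restrict Ω) := by
    obtain ⟨C, hC⟩ := exists_norm_le_of_isBounded hb hGc
    refine ((Lp.memLp φ).integrable le_top).mul_bdd (c := C) hGc.aestronglyMeasurable ?_
    exact (ae_restrict_mem hm).mono fun z hz => hC z hz
  obtain ⟨R, hR⟩ := hb.exists_norm_le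
  have hw : ∀ a b : Fin n → ℕ, HasWeight Ω (fun i => (a i : ℤ) - b i) fun z =>
      φ z * G z * ∏ i, (z i ^ a i * (starRingEnd ℂ) (z i) ^ b i) := by
    intro a b
    have ha := hasWeight_monomialFun Ω (δ := fun i => ((a i + 1 : ℕ) : ℤ) + γ i)
      fun i => add_nonneg (by positivity) (hγ i)
    have hb' := (hasWeight_monomialFun Ω (δ := fun i => ((b i + 1 : ℕ) : ℤ) + (γ + k) i)
      fun i => add_nonneg (by positivity) (hγk i)).conj
    have hab := (hφ.mul ha).mul hb'
    convert hab using 1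
    · ext i
      simp
      ring
    · ext z
      rw [monomialFun_natCast_add _ hγ, monomialFun_natCast_add _ hγk, hG, map_mul, map_prod]
      simp only [map_mul, map_pow, pow_succ, Finset.prod_mul_distrib]
      ring
  have hzero := integral_comp_eq_zero_of_moments hHint (X := fun z => z) measurable_id
    (R := R) ((ae_restrict_mem hm).mono fun z hz => hR z hz) (fun a b => by
      -- Diagonal moments vanish by hypothesis, the others because their weight `a - b` is nonzero.
      by_cases hab : a = b
      · subst hab
        rw [← hmom a]
        refine integral_congr_ae (Eventually.of_forall fun z => ?_)
        simp only [hG, pow_succ, Finset.prod_mul_distrib, mul_pow]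
        ring
      · refine (hw a b).integral_eq_zero hrein hm fun h => hab (funext fun i => ?_)
        have := congrFun h i
        simp only [Pi.zero_apply] at this
        omega)
  have hae : ∀ᵐ z ∂(volume.restrict Ω), φ z * G z = 0 := by
    refine ae_eq_zero_of_integral_contDiff_smul_eq_zero hHint.locallyIntegrable
      fun g hg _ => ?_
    rw [← hzero ⟨fun z => (g z : ℂ), Complex.continuous_ofReal.comp hg.continuous⟩]
    refine integral_congr_ae (Eventually.of_forall fun z => ?_)
    simp [mul_comm]
  refine Lp.ext ?_
  filter_upwards [hae, ae_restrict_of_ae (ae_coord_ne_zero n), Lp.coeFn_zero ℂ ∞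
    (volume.restrict Ω)] with z h1 h2 h3
  rw [h3]
  refine (mul_eq_zero.1 h1).resolve_right ?_
  refine mul_ne_zero (mul_ne_zero (monomialFun_ne_zero γ h2) ?_) ?_
  · exact (map_ne_zero _).2 (monomialFun_ne_zero _ h2)
  · exact Finset.prod_ne_zero_iff.2 fun i _ => mul_ne_zero (h2 i) ((map_ne_zero _).2 (h2 i))

theorem exists_lower_bound {ι : Type*} [Finite ι] {n : ℕ} (f : ι → Fin n → ℤ) :
    ∃ b : ℤ, 0 ≤ b ∧ ∀ x i, -b ≤ f x i := by
  obtain ⟨c, hc⟩ := (Set.finite_range fun p : ι × Fin n => f p.1 p.2).bddBelow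
  refine ⟨|c|, abs_nonneg c, fun x i => (neg_abs_le c).trans (hc ⟨(x, i), rfl⟩)⟩

/-- If the products of the matrix coefficients of finitely many bounded functions of given weights
vanish in all large degrees, then one of the functions is zero. -/
theorem exists_eq_zero_of_prod_moments_eq_zero {n m : ℕ} {Ω : Set (Fin n → ℂ)}
    (hm : MeasurableSet Ω) (hb : Bornology.IsBounded Ω) (hrein : IsReinhardt Ω)
    {φ : Fin m → Lp ℂ ∞ (volume.restrict Ω)} {κ γ : Fin m → Fin n → ℤ}
    (hφ : ∀ j, HasWeight Ω (κ j) (φ j)) (hγ : ∀ j i, 0 ≤ γ j i) (hγκ : ∀ j i, 0 ≤ (γ j + κ j) i)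
    (hprod : ∀ a : Fin n → ℕ, ∏ j, ∫ z in Ω, φ j z * monomialFun (fun i => (a i : ℤ) + γ j i) z *
      (starRingEnd ℂ) (monomialFun (fun i => (a i : ℤ) + (γ j + κ j) i) z) = 0) :
    ∃ j, φ j = 0 := by
  have := isFiniteMeasure_restrict_of_isBounded hb
  obtain ⟨R, hR, hRΩ⟩ := hb.exists_pos_norm_le
  have hRne : (R : ℂ) ≠ 0 := Complex.ofReal_ne_zero.2 hR.ne'
  -- The truncation by `1` is inactive on `Ω`; it provides the bound outside `Ω`, since
  -- `exists_moments_eq_zero` asks for it at every point.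
  let X : (Fin n → ℂ) → Fin n → ℝ := fun z i => min 1 (‖z i‖ ^ 2 / R ^ 2)
  let h : Fin m → (Fin n → ℂ) → ℂ := fun j z =>
    φ j z * monomialFun (γ j) z * (starRingEnd ℂ) (monomialFun (γ j + κ j) z)
  have hX : Continuous X := by fun_prop
  have hXΩ : ∀ z ∈ Ω, ∀ i, z i * (starRingEnd ℂ) (z i) = (R : ℂ) ^ 2 * X z i := by
    intro z hz i
    have h1 : ‖z i‖ ^ 2 / R ^ 2 ≤ 1 := by
      rw [div_le_one (by positivity)]
      have := (norm_le_pi_norm z i).trans (hRΩ z hz)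
      gcongr
    simp only [X]
    rw [min_eq_right h1, Complex.mul_conj']
    push_cast
    field_simp
  have hh : ∀ j, Integrable (h j) (volume.restrict Ω) := by
    intro j
    have hc : Continuous fun z : Fin n → ℂ =>
        monomialFun (γ j) z * (starRingEnd ℂ) (monomialFun (γ j + κ j) z) :=
      (continuous_monomialFun _).mul (Complex.continuous_conj.comp (continuous_monomialFun _))
    obtain ⟨C, hC⟩ := exists_norm_le_of_isBounded hb hc
    simp only [h, mul_assoc]
    exact ((Lp.memLp (φ j)).integrable le_top).mul_bdd (c := C) hc.aestronglyMeasurable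
      ((ae_restrict_mem hm).mono fun z hz => hC z hz)
  have hscale : ∀ j (e : Fin n → ℕ), ∫ z in Ω, h j z * ∏ i, (z i * (starRingEnd ℂ) (z i)) ^ e i =
      (∏ i, ((R : ℂ) ^ 2) ^ e i) * ∫ z in Ω, h j z * ∏ i, (X z i : ℂ) ^ e i := by
    intro j e
    rw [← integral_const_mul]
    refine setIntegral_congr_fun hm fun z hz => ?_
    simp only [hXΩ z hz, mul_pow, Finset.prod_mul_distrib]
    ring
  obtain ⟨j, hj⟩ := exists_moments_eq_zero hX.measurable (μ := volume.restrict Ω)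
    (fun z i => le_min zero_le_one (by positivity)) (fun z i => min_le_left _ _) hh (fun a => by
      have h1 := hprod a
      rw [Finset.prod_eq_zero_iff] at h1 ⊢
      obtain ⟨j, hj, h1⟩ := h1
      refine ⟨j, hj, ?_⟩
      have h2 := hscale j a
      have h3 : ∫ z in Ω, h j z * ∏ i, (z i * (starRingEnd ℂ) (z i)) ^ a i = 0 := by
        rw [← h1]
        refine integral_congr_ae (Eventually.of_forall fun z => ?_)
        simp only [h]
        rw [monomialFun_natCast_add _ (hγ j), monomialFun_natCast_add _ (hγκ j)]
        simp only [mul_pow, Finset.prod_mul_distrib, map_mul, map_prod, map_pow]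
        ring
      rw [h3] at h2
      exact (mul_eq_zero.1 h2.symm).resolve_left
        (Finset.prod_ne_zero_iff.2 fun i _ => pow_ne_zero _ (pow_ne_zero _ hRne)))
  refine ⟨j, eq_zero_of_moments_eq_zero hm hb hrein (hφ j) (hγ j) (hγκ j) fun a => ?_⟩
  have h2 := hscale j fun i => a i + 1
  rw [hj a, mul_zero] at h2
  exact h2

/-! ### Vanishing of the leading coefficients and conclusion -/

/-- If a product of finite sums of weighted shifts of an orthogonal family vanishes, then so do the
products of the coefficients of the lexicographically largest shifts. -/
theorem exists_prod_leading_coeff_eq_zero {V : Type*} [NormedAddCommGroup V]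
    [InnerProductSpace ℂ V] {n : ℕ} {E : (Fin n → ℤ) → V} (hE : ∀ δ, E δ ≠ 0)
    (horth : ∀ γ δ : Fin n → ℤ, (∀ i, 0 ≤ γ i) → (∀ i, 0 ≤ δ i) → γ ≠ δ →
      inner ℂ (E γ) (E δ) = 0) {m : ℕ} (T : Fin m → V →L[ℂ] V)
    (K : Fin m → Finset (Fin n → ℤ)) (κ : Fin m → Fin n → ℤ)
    (c : Fin m → (Fin n → ℤ) → (Fin n → ℤ) → ℂ) (hκ : ∀ j, κ j ∈ K j)
    (hmax : ∀ j, ∀ k ∈ K j, toLex k ≤ toLex (κ j))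
    (hT : ∀ j δ, (∀ i, 0 ≤ δ i) → (∀ k ∈ K j, ∀ i, 0 ≤ (δ + k) i) →
      T j (E δ) = ∑ k ∈ K j, c j k δ • E (δ + k))
    (hprod : (List.ofFn T).reverse.prod = 0) :
    ∃ γ : Fin m → Fin n → ℤ, (∀ j i, 0 ≤ γ j i) ∧ (∀ j i, 0 ≤ (γ j + κ j) i) ∧
      ∀ a : Fin n → ℕ, ∏ j, c j (κ j) (fun i => (a i : ℤ) + γ j i) = 0 := by
  obtain ⟨b, hb0, hb⟩ := exists_lower_bound fun x : Σ j, K j => (x.2 : Fin n → ℤ)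
  obtain ⟨s, S, h⟩ := exists_prod_apply_sub_mem_lowerSpan E hb0 T K κ c
    (fun j k hk => hb ⟨j, k, hk⟩) hκ
    (fun j k hk hne => (hmax j k hk).lt_of_ne fun h => hne (toLex.injective h))
    (fun j δ hδ => hT j δ (fun i => hb0.trans (hδ i)) fun k hk i => by
      have h1 := hδ i
      have h2 := hb ⟨j, k, hk⟩ i
      simp only [Pi.add_apply] at h2 ⊢
      linarith)
  -- A common lower bound for `S`, all `s j` and all `s j + κ j`. Starting from degree `a + B + m *
  -- b` then leaves room for `m` shifts and keeps every degree involved nonnegative.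
  obtain ⟨B, hB0, hB⟩ := exists_lower_bound fun x : Option (Fin m ⊕ Fin m) =>
    x.elim S (Sum.elim s fun j => s j + κ j)
  have hmb : 0 ≤ (m : ℤ) * b := by positivity
  have hBS : ∀ i, -B ≤ S i := hB none
  have hBs : ∀ j i, -B ≤ s j i := fun j => hB (some (Sum.inl j))
  have hBκ : ∀ j i, -B ≤ s j i + κ j i := fun j => hB (some (Sum.inr j))
  refine ⟨fun j i => B + m * b + s j i, fun j i => by linarith [hBs j i],
    fun j i => by simp only [Pi.add_apply]; linarith [hBκ j i], fun a => ?_⟩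
  set δ : Fin n → ℤ := fun i => a i + (B + m * b) with hδ
  have hδS : ∀ i, 0 ≤ (δ + S) i := fun i => by
    simp only [hδ, Pi.add_apply]
    linarith [hBS i, Int.natCast_nonneg (a i)]
  have hmem := (h 0 le_rfl δ).1 fun i => by
    simp only [hδ]
    linarith [Int.natCast_nonneg (a i)]
  -- The lower terms have nonnegative degrees different from `δ + S`, so pairing with `E (δ + S)`
  -- isolates the leading coefficient.
  have hperp : ∀ v ∈ lowerSpan E 0 (δ + S), inner ℂ (E (δ + S)) v = 0 := by
    intro v hv
    unfold lowerSpan at hv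
    induction hv using Submodule.span_induction with
    | mem x hx =>
      obtain ⟨γ, ⟨hγ, hlt⟩, rfl⟩ := hx
      exact horth _ _ hδS hγ fun h => hlt.ne (by rw [h])
    | zero => exact inner_zero_right _
    | add x y _ _ hx hy => rw [inner_add_right, hx, hy, add_zero]
    | smul c x _ hx => rw [inner_smul_right, hx, mul_zero]
  have h1 := hperp _ hmem
  rw [hprod, zero_apply, zero_sub, inner_neg_right, neg_eq_zero, inner_smul_right] at h1
  have h2 := (mul_eq_zero.1 h1).resolve_right (inner_self_ne_zero.2 (hE _))
  rw [← h2]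
  refine Finset.prod_congr rfl fun j _ => congrArg _ (funext fun i => ?_)
  simp only [hδ, Pi.add_apply]
  ring

end ReinhardtToeplitz

open ReinhardtToeplitz in
theorem theorem1p1 {n m : ℕ} (Ω : TopologicalSpace.Opens (Fin n → ℂ))
    (hconn : IsConnected (Ω : Set (Fin n → ℂ)))
    (hbdd : Bornology.IsBounded (Ω : Set (Fin n → ℂ)))
    (hrein : ReinhardtToeplitz.IsReinhardt (Ω : Set (Fin n → ℂ)))
    (φ : Fin m → Lp ℂ ∞ (volume.restrict (Ω : Set (Fin n → ℂ))))
    (hφ : ∀ j, ReinhardtToeplitz.IsFiniteSumQuasiHomogeneous (φ j))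
    (hT : (List.ofFn fun j => ReinhardtToeplitz.toeplitz Ω (φ j)).reverse.prod = 0) :
    ∃ j, φ j = 0 := by
  by_contra! hne
  have hm := Ω.isOpen.measurableSet
  choose K Φ hw hK hsum using fun j => (hφ j).exists_decomposition hm hrein
  have hKne : ∀ j, (K j).Nonempty := fun j =>
    Finset.nonempty_iff_ne_empty.2 fun h => hne j (by rw [hsum j, h, Finset.sum_empty])
  choose κ hκ hκmax using fun j => Finset.exists_max_image (K j) toLex (hKne j)
  obtain ⟨γ, hγ, hγκ, hzero⟩ := exists_prod_leading_coeff_eq_zero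
    (E := monomialVec Ω hbdd) (monomialVec_ne_zero hconn.nonempty hbdd)
    (fun γ δ hγ hδ hne => inner_monomialVec_eq_zero hbdd hrein hγ hδ hne)
    (fun j => toeplitz Ω (φ j)) K κ _ hκ hκmax
    (fun j δ hδ hδk => by
      rw [hsum j, toeplitz_sum]
      exact Finset.sum_congr rfl fun k hk =>
        toeplitz_monomialVec hconn hbdd hrein (hw j k) hδ (hδk k hk)) hT
  obtain ⟨j, hj⟩ := exists_eq_zero_of_prod_moments_eq_zero hm hbdd hrein
    (φ := fun j => Φ j (κ j)) (fun j => hw j _) hγ hγκ (fun a => by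
      have h := hzero a
      rw [Finset.prod_eq_zero_iff] at h ⊢
      obtain ⟨j, hj, h⟩ := h
      refine ⟨j, hj, ?_⟩
      -- Only the numerator of a shift coefficient can vanish, the denominator being the squared
      -- norm of a nonzero monomial.
      have h1 := (div_eq_zero_iff.1 h).resolve_right
        (inner_self_ne_zero.2 (monomialVec_ne_zero hconn.nonempty hbdd _))
      have h2 : (fun i => (a i : ℤ) + γ j i) + κ j = fun i => (a i : ℤ) + (γ j + κ j) i :=
        funext fun i => add_assoc _ _ _
      rw [h2] at h1
      exact h1)
  exact hK j (κ j) (hκ j) hj
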